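/- Let $d\ge 2$, let $\Omega\subset\mathbb R^d$ be a bounded domain (nonempty, open, connected), $T>0$, $\nu\ge 0$. Let $C^\infty_{c,\sigma}(\Omega)$ be the smooth divergence-free fields with compact support in $\Omega$, and $L^2_\sigma$, $H^1_{0,\sigma}$ its closures in $L^2(\Omega)^d$ and $H^1(\Omega)^d$. If $\nu>0$, put $\mathbb X=L^\infty(0,T;L^2_\sigma)\cap L^2(0,T;H^1_{0,\sigma})$, $\mathbb Y=\mathbb X\cap L^2(0,T;H^2)\cap L^1(0,T;W^{1,\infty})\cap H^1(0,T;(L^2_\sigma)^*)$, $\mathbb Z=L^2(0,T;H^{-1})\oplus L^1(0,T;L^2)$; if $\nu=0$, put $\mathbb X=L^\infty(0,T;L^2_\sigma)$, $\mathbb Y=\mathbb X\cap L^1(0,T;W^{1,\infty})\cap H^1(0,T;(L^2_\sigma)^*)$, $\mathbb Z=L^1(0,T;L^2)$. Let $f\in\mathbb Z$ and $v_0\in L^2_\sigma$. Elements of $\mathbb Y$ are taken in their continuous representative $[0,T]\to L^2_\sigma$. Put $\mathcal R(v|\tilde v)=\frac12\|v-\tilde v\|_{L^2}^2$ and $\langle\mathcal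 A_\nu(\tilde v),\cdot\rangle=\langle\partial_t\tilde v+(\tilde v\cdot\nabla)\tilde v-\nu\Delta\tilde v-f,\cdot\rangle$. For $\mathcal K:L^2_\sigma\to[0,\infty]$ put $\mathcal D(\mathcal K)=\{\tilde v\in\mathbb X:\mathcal K(\tilde v)\in L^1(0,T)\}$ and $$\mathcal W_\nu(v|\tilde v)=\nu\|\nabla v-\nabla\tilde v\|_{L^2}^2-\int_\Omega((v-\tilde v)\cdot\nabla)(v-\tilde v)\cdot\tilde v\,dx+\mathcal K(\tilde v)\mathcal R(v|\tilde v)\quad(\nu>0),$$ $$\mathcal W_0(v|\tilde v)=\int_\Omega(v-\tilde v)^T(\nabla\tilde v)_{\rm sym}(v-\tilde v)\,dx+\mathcal K(\tilde v)\mathcal R(v|\tilde v).$$ $\mathcal K$ is called admissible if $\mathcal K(0)=0$; $C^1([0,T];C^\infty_{c,\sigma}(\Omega))\subset\mathcal D(\mathcal K)$; there is a topology on $\mathcal D(\mathcal K)$ for which this subset is dense and $\mathcal K:\mathcal D(\mathcal K)\to L^1(0,T)$ is continuous; and $\mathcal W_\nu(v|\tilde v)\ge0$ a.e. in $(0,T)$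 for all $v\in\mathbb X$ and $\tilde v\in\mathbb Y\cap\mathcal D(\mathcal K)$. A pair $(v,\xi)\in\mathbb X\times L^\infty(0,T)$ with $\xi(t)\ge0$ for all $t\in(0,T)$ is an energy-variational solution if, for every admissible $\mathcal K$, every $\tilde v\in\mathbb Y\cap\mathcal D(\mathcal K)$ and all $0\le s\le t\le T$, $$[\mathcal R(v|\tilde v(t))+\xi](t+)+\int_s^t\Big(\mathcal W_\nu(v|\tilde v)+\langle\mathcal A_\nu(\tilde v),v-\tilde v\rangle-\mathcal K(\tilde v)\big(\mathcal R(v|\tilde v)+\xi\big)\Big)d\tau\le[\mathcal R(v|\tilde v(s))+\xi](s-),$$ where $(t+)$ and $(s-)$ denote essential right and left limits in time, required to exist (at $t=T$ and at $s=0$ the limit is taken from inside $(0,T)$), and if $v(\tau)\rightharpoonup v_0$ weakly in $L^2_\sigma$ as $\tau\searrow0$ (essential limit). Claim. Let $(v,\xi)$ be an energy-variational solution, let $0<s<t<T$, and assume $\xi(\tau)=0$ for a.e. $\tau\in(s,t)$. Then there is a null set $N\subset\mathbb R$ such that for all $q<r$ in $(s,t)\setminus N$ $$\tfrac12\|v(r)\|_{L^2}^2-\tfrac12\|v(q)\|_{L^2}^2+\int_q^r\big(\nu\|\nabla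 v\|_{L^2}^2-\langle f,v\rangle\big)\,d\tau\le0,$$ and for every $\varphi\in C^1_c((s,t);C^\infty_{c,\sigma}(\Omega))$ $$\int_s^t\big(\nu(\nabla v,\nabla\varphi)-(v\otimes v;\nabla\varphi)-(v,\partial_t\varphi)-\langle f,\varphi\rangle\big)\,d\tau=0 .$$ -/

import Mathlib

open MeasureTheory Set Filter Topology
open scoped ENNReal ContDiff

noncomputable section

namespace EnergyVariational

/-- Euclidean space `ℝᵈ`. -/
abbrev Eu (d : ℕ) : Type := EuclideanSpace ℝ (Fin d)

/-- `L²(Ω; ℝ^ι)` with the Euclidean norm on `ℝ^ι`. -/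
abbrev L2 {d : ℕ} (Ω : Set (Eu d)) (ι : Type) [Fintype ι] : Type :=
  Lp (EuclideanSpace ℝ ι) 2 (volume.restrict Ω)

/-- Lebesgue measure on the time interval `(0,T)`. -/
abbrev timeMeasure (T : ℝ) : Measure ℝ := volume.restrict (Ioo 0 T)

/-! ### Smooth functions and weak derivatives -/

/-- The classical gradient (Jacobian) of a vector field; the entry `(i, j)` is `∂ⱼ φᵢ`.
As an element of `EuclideanSpace` it carries the Frobenius inner product. -/
def grad {d : ℕ} (φ : Eu d → Eu d) (x : Eu d) : EuclideanSpace ℝ (Fin d × Fin d) :=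
  WithLp.toLp 2 fun p => (fderiv ℝ φ x (EuclideanSpace.single p.2 1)) p.1

/-- The classical divergence of a vector field. -/
def diverg {d : ℕ} (φ : Eu d → Eu d) (x : Eu d) : ℝ :=
  ∑ i, grad φ x (i, i)

/-- `C_c^∞(Ω; F)`. -/
def IsTest {d : ℕ} (Ω : Set (Eu d)) {F : Type} [NormedAddCommGroup F] [NormedSpace ℝ F]
    (φ : Eu d → F) : Prop :=
  ContDiff ℝ ∞ φ ∧ HasCompactSupport φ ∧ tsupport φ ⊆ Ω

/-- `C_{c,σ}^∞(Ω; ℝᵈ)`: smooth solenoidal vector fields with compact support in `Ω`. -/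
def IsSolTest {d : ℕ} (Ω : Set (Eu d)) (φ : Eu d → Eu d) : Prop :=
  IsTest Ω φ ∧ ∀ x, diverg φ x = 0

/-- `G` is the weak gradient of `u` in `Ω`; the entry `(i, j)` is `∂ⱼ uᵢ`. -/
def IsWeakGrad {d : ℕ} (Ω : Set (Eu d)) {ι : Type} [Fintype ι]
    (u : L2 Ω ι) (G : L2 Ω (ι × Fin d)) : Prop :=
  ∀ η : Eu d → ℝ, IsTest Ω η → ∀ (i : ι) (j : Fin d),
    ∫ x in Ω, u x i * fderiv ℝ η x (EuclideanSpace.single j 1) =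
      - ∫ x in Ω, G x (i, j) * η x

open Classical in
/-- The weak gradient of `u` if `u` has one in `L²(Ω)`, and `0` otherwise. -/
def weakGrad {d : ℕ} (Ω : Set (Eu d)) {ι : Type} [Fintype ι] (u : L2 Ω ι) :
    L2 Ω (ι × Fin d) :=
  if h : ∃ G, IsWeakGrad Ω u G then h.choose else 0

/-! ### Function spaces on `Ω` -/

/-- `L²_σ(Ω)`: the closure of `C_{c,σ}^∞(Ω; ℝᵈ)` in `L²(Ω)`. -/
def L2sol {d : ℕ} (Ω : Set (Eu d)) : Submodule ℝ (L2 Ω (Fin d)) :=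
  (Submodule.span ℝ {u : L2 Ω (Fin d) | ∃ φ : Eu d → Eu d, IsSolTest Ω φ ∧
    u =ᵐ[volume.restrict Ω] φ}).topologicalClosure

/-- `H¹₀(Ω; ℝᵈ)`: the closure of `C_c^∞(Ω; ℝᵈ)` in `H¹`, where `u ∈ H¹` is identified with
`(u, ∇u) ∈ L² × L²` (the product norm is equivalent to the `H¹`-norm). -/
def H10 {d : ℕ} (Ω : Set (Eu d)) : Submodule ℝ (L2 Ω (Fin d) × L2 Ω (Fin d × Fin d)) :=
  (Submodule.span ℝ {p : L2 Ω (Fin d) × L2 Ω (Fin d × Fin d) | ∃ φ : Eu d → Eu d,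
    IsTest Ω φ ∧ p.1 =ᵐ[volume.restrict Ω] φ ∧
      p.2 =ᵐ[volume.restrict Ω] grad φ}).topologicalClosure

/-- `H¹_{0,σ}(Ω)`: the closure of `C_{c,σ}^∞(Ω; ℝᵈ)` in `H¹`, again as pairs `(u, ∇u)`. -/
def H10sol {d : ℕ} (Ω : Set (Eu d)) : Submodule ℝ (L2 Ω (Fin d) × L2 Ω (Fin d × Fin d)) :=
  (Submodule.span ℝ {p : L2 Ω (Fin d) × L2 Ω (Fin d × Fin d) | ∃ φ : Eu d → Eu d,
    IsSolTest Ω φ ∧ p.1 =ᵐ[volume.restrict Ω] φ ∧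
      p.2 =ᵐ[volume.restrict Ω] grad φ}).topologicalClosure

/-- `H⁻¹(Ω)`, the dual space of `H¹₀(Ω; ℝᵈ)`. -/
abbrev Hm1 {d : ℕ} (Ω : Set (Eu d)) : Type := StrongDual ℝ (H10 Ω)

open Classical in
/-- The duality pairing `⟨F, u⟩` of `H⁻¹(Ω)` and `H¹₀(Ω)` (junk value `0` if `u ∉ H¹₀(Ω)`). -/
def hm1Pair {d : ℕ} {Ω : Set (Eu d)} (F : Hm1 Ω) (u : L2 Ω (Fin d)) : ℝ :=
  if h : (u, weakGrad Ω u) ∈ H10 Ω then F ⟨(u, weakGrad Ω u), h⟩ else 0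

/-- The pairing of an element of `H⁻¹(Ω) ⊕ L²(Ω)` with a vector field. -/
def forcePair {d : ℕ} {Ω : Set (Eu d)} (F : Hm1 Ω × L2 Ω (Fin d)) (u : L2 Ω (Fin d)) : ℝ :=
  hm1Pair F.1 u + inner ℝ F.2 u

open Classical in
/-- The class in `L²(Ω; ℝᵈ)` of a square integrable vector field. -/
def toL2 {d : ℕ} (Ω : Set (Eu d)) (φ : Eu d → Eu d) : L2 Ω (Fin d) :=
  if h : MemLp φ 2 (volume.restrict Ω) then h.toLp φ else 0

/-! ### Functions of time and space -/

/-- The pointwise time derivative `∂ₜφ`. -/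
def timeDeriv {d : ℕ} (φ : ℝ → Eu d → Eu d) (τ : ℝ) (x : Eu d) : Eu d :=
  deriv (fun σ => φ σ x) τ

/-- `C¹(ℝ; C_{c,σ}^∞(Ω; ℝᵈ))` with supports in one compact subset of `Ω`: all spatial derivatives
of `φ` are differentiable in time, and the results are the spatial derivatives of `∂ₜφ`, which are
jointly continuous. (On a compact set of times this is continuous differentiability with respect
to the usual topology of `C_c^∞(Ω)`.) -/
structure IsC1Sol {d : ℕ} (Ω : Set (Eu d)) (φ : ℝ → Eu d → Eu d) : Prop where
  support : ∃ C : Set (Eu d), IsCompact C ∧ C ⊆ Ω ∧ ∀ τ, ∀ x ∉ C, φ τ x = 0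
  smooth : ∀ τ, ContDiff ℝ ∞ (φ τ)
  solenoidal : ∀ τ x, diverg (φ τ) x = 0
  smooth_timeDeriv : ∀ τ, ContDiff ℝ ∞ (timeDeriv φ τ)
  hasDerivAt : ∀ (n : ℕ) (τ : ℝ) (x : Eu d),
    HasDerivAt (fun σ => iteratedFDeriv ℝ n (φ σ) x) (iteratedFDeriv ℝ n (timeDeriv φ τ) x) τ
  continuous : ∀ n : ℕ,
    Continuous fun p : ℝ × Eu d => iteratedFDeriv ℝ n (timeDeriv φ p.1) p.2

/-- `C¹_c((s,t); C_{c,σ}^∞(Ω; ℝᵈ))`. -/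
def IsC1cSol {d : ℕ} (Ω : Set (Eu d)) (s t : ℝ) (φ : ℝ → Eu d → Eu d) : Prop :=
  IsC1Sol Ω φ ∧ ∃ J : Set ℝ, IsCompact J ∧ J ⊆ Ioo s t ∧ ∀ τ ∉ J, ∀ x, φ τ x = 0

/-- `u ∈ C¹([0,T]; C_{c,σ}^∞(Ω; ℝᵈ))`. -/
def IsC1SolOn {d : ℕ} (Ω : Set (Eu d)) (T : ℝ) (u : ℝ → L2sol Ω) : Prop :=
  ∃ φ : ℝ → Eu d → Eu d, IsC1Sol Ω φ ∧
    ∀ τ ∈ Icc 0 T, (u τ : L2 Ω (Fin d)) =ᵐ[volume.restrict Ω] φ τ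

/-- The energy space: `L^∞(0,T; L²_σ) ∩ L²(0,T; H¹_{0,σ})` for `ν > 0`, and
`L^∞(0,T; L²_σ)` for `ν = 0`. -/
structure MemX {d : ℕ} (Ω : Set (Eu d)) (T ν : ℝ) (v : ℝ → L2sol Ω) : Prop where
  bounded : MemLp v ⊤ (timeMeasure T)
  mem_H10sol : 0 < ν → ∀ᵐ τ ∂(timeMeasure T),
    ((v τ : L2 Ω (Fin d)), weakGrad Ω (v τ : L2 Ω (Fin d))) ∈ H10sol Ω
  grad_memLp : 0 < ν →
    MemLp (fun τ => weakGrad Ω (v τ : L2 Ω (Fin d))) 2 (timeMeasure T)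

/-- The space of test functions: `X ∩ L²(0,T; H²) ∩ L¹(0,T; W^{1,∞}) ∩ H¹(0,T; (L²_σ)^*)`
for `ν > 0`, and the same without `L²(0,T; H²)` for `ν = 0`.
Here `w` is the weak time derivative of `u`, with `(L²_σ)^* ≅ L²_σ`, and `u` is the continuous
representative. A function with values in `W^{1,∞}` is given by the pair `(V, D)` of the
function and its gradient, both in `L^∞(Ω)`. -/
structure MemY {d : ℕ} (Ω : Set (Eu d)) (T ν : ℝ) (u w : ℝ → L2sol Ω) : Prop where
  memX : MemX Ω T ν u
  hasWeakGrad : ∀ᵐ τ ∂(timeMeasure T),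
    IsWeakGrad Ω (u τ : L2 Ω (Fin d)) (weakGrad Ω (u τ : L2 Ω (Fin d)))
  hasWeakGrad_two : 0 < ν → ∀ᵐ τ ∂(timeMeasure T),
    IsWeakGrad Ω (weakGrad Ω (u τ : L2 Ω (Fin d)))
      (weakGrad Ω (weakGrad Ω (u τ : L2 Ω (Fin d))))
  memLp_two : 0 < ν →
    MemLp (fun τ => weakGrad Ω (weakGrad Ω (u τ : L2 Ω (Fin d)))) 2 (timeMeasure T)
  lipschitz : ∃ (V : ℝ → Lp (Eu d) ⊤ (volume.restrict Ω))
      (D : ℝ → Lp (EuclideanSpace ℝ (Fin d × Fin d)) ⊤ (volume.restrict Ω)),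
    MemLp V 1 (timeMeasure T) ∧ MemLp D 1 (timeMeasure T) ∧
    ∀ᵐ τ ∂(timeMeasure T),
      V τ =ᵐ[volume.restrict Ω] (u τ : L2 Ω (Fin d)) ∧
      D τ =ᵐ[volume.restrict Ω] weakGrad Ω (u τ : L2 Ω (Fin d))
  timeDeriv_memLp : MemLp w 2 (timeMeasure T)
  hasTimeDeriv : ∀ t ∈ Icc 0 T, u t = u 0 + ∫ τ in (0 : ℝ)..t, w τ

/-- The space of right-hand sides: `L²(0,T; H⁻¹) ⊕ L¹(0,T; L²)` for `ν > 0`, and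
`L¹(0,T; L²)` for `ν = 0`. -/
structure MemZ {d : ℕ} (Ω : Set (Eu d)) (T ν : ℝ) (f : ℝ → Hm1 Ω × L2 Ω (Fin d)) : Prop where
  fst_memLp : MemLp (fun τ => (f τ).1) 2 (timeMeasure T)
  snd_memLp : MemLp (fun τ => (f τ).2) 1 (timeMeasure T)
  fst_eq_zero : ν = 0 → ∀ᵐ τ ∂(timeMeasure T), (f τ).1 = 0

/-! ### The relative energy, the system operator and the relative form -/

/-- The relative energy `R(v | u) = ½ ‖v - u‖²`. -/
def relEnergy {d : ℕ} {Ω : Set (Eu d)} (v u : L2sol Ω) : ℝ := 1 / 2 * ‖v - u‖ ^ 2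

/-- `∫_Ω (a · ∇) b · c dx`, where `G = ∇b`. -/
def convForm {d : ℕ} {Ω : Set (Eu d)} (a : L2 Ω (Fin d)) (G : L2 Ω (Fin d × Fin d))
    (c : L2 Ω (Fin d)) : ℝ :=
  ∫ x in Ω, ∑ i, ∑ j, a x j * G x (i, j) * c x i

/-- `∫_Ω aᵀ (G)_sym a dx`. -/
def symForm {d : ℕ} {Ω : Set (Eu d)} (a : L2 Ω (Fin d)) (G : L2 Ω (Fin d × Fin d)) : ℝ :=
  ∫ x in Ω, ∑ i, ∑ j, a x i * ((G x (i, j) + G x (j, i)) / 2) * a x j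

/-- `∫_Ω Δu · c dx`. -/
def laplaceForm {d : ℕ} {Ω : Set (Eu d)} (u c : L2 Ω (Fin d)) : ℝ :=
  ∫ x in Ω, ∑ i, ∑ j, weakGrad Ω (weakGrad Ω u) x ((i, j), j) * c x i

/-- `⟨A_ν(u), c⟩ = ⟨∂ₜu + (u · ∇)u - νΔu - f, c⟩` at a fixed time, with `w = ∂ₜu`. -/
def systemOp {d : ℕ} {Ω : Set (Eu d)} (ν : ℝ) (F : Hm1 Ω × L2 Ω (Fin d))
    (u w c : L2 Ω (Fin d)) : ℝ :=
  inner ℝ w c + convForm u (weakGrad Ω u) c - ν * laplaceForm u c - forcePair F c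

open Classical in
/-- The relative form `W_ν(v | u)` at a fixed time. -/
def relForm {d : ℕ} {Ω : Set (Eu d)} (ν : ℝ) (K : L2sol Ω → ℝ≥0∞) (v u : L2sol Ω) : ℝ :=
  (if ν = 0 then
    symForm ((v - u : L2sol Ω) : L2 Ω (Fin d)) (weakGrad Ω (u : L2 Ω (Fin d)))
  else
    ν * ‖weakGrad Ω (v : L2 Ω (Fin d)) - weakGrad Ω (u : L2 Ω (Fin d))‖ ^ 2
      - convForm ((v - u : L2sol Ω) : L2 Ω (Fin d))
          (weakGrad Ω (v : L2 Ω (Fin d)) - weakGrad Ω (u : L2 Ω (Fin d))) u)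
  + (K u).toReal * relEnergy v u

/-! ### Admissible regularity measures -/

/-- The domain `D(K) = {u ∈ X | K(u) ∈ L¹(0,T)}`. -/
def KDomain {d : ℕ} (Ω : Set (Eu d)) (T ν : ℝ) (K : L2sol Ω → ℝ≥0∞) :
    Set (ℝ → L2sol Ω) :=
  {u | MemX Ω T ν u ∧ AEMeasurable (fun τ => K (u τ)) (timeMeasure T) ∧
    ∫⁻ τ, K (u τ) ∂(timeMeasure T) ≠ ⊤}

/-- `K` as a map from `D(K)` to `L¹(0,T)`. -/
def KMap {d : ℕ} (Ω : Set (Eu d)) (T ν : ℝ) (K : L2sol Ω → ℝ≥0∞)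
    (u : KDomain Ω T ν K) : Lp ℝ 1 (timeMeasure T) :=
  (integrable_toReal_of_lintegral_ne_top u.2.2.1 u.2.2.2).toL1
    (fun τ => (K ((u : ℝ → L2sol Ω) τ)).toReal)

/-- Admissibility of `K : L²_σ(Ω) → [0,∞]`: `K(0) = 0`; for some topology on `D(K)` the map `K` is
continuous and `C¹([0,T]; C_{c,σ}^∞(Ω))` is a dense subset of `D(K)`; and `W_ν ≥ 0`. -/
structure IsAdmissible {d : ℕ} (Ω : Set (Eu d)) (T ν : ℝ) (K : L2sol Ω → ℝ≥0∞) : Prop where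
  map_zero : K 0 = 0
  subset_domain : ∀ u, IsC1SolOn Ω T u → u ∈ KDomain Ω T ν K
  exists_topology : ∃ 𝒯 : TopologicalSpace (KDomain Ω T ν K),
    @Continuous _ _ 𝒯 _ (KMap Ω T ν K) ∧
    @Dense _ 𝒯 {u : KDomain Ω T ν K | IsC1SolOn Ω T (u : ℝ → L2sol Ω)}
  relForm_nonneg : ∀ v, MemX Ω T ν v → ∀ u w, MemY Ω T ν u w → u ∈ KDomain Ω T ν K →
    ∀ᵐ τ ∂(timeMeasure T), 0 ≤ relForm ν K (v τ) (u τ)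

/-! ### Energy-variational solutions -/

/-- The filter of the (essential) limit `t+`, with the inner one-sided limit at the end point
`T`. -/
def rightLim (T t : ℝ) : Filter ℝ := (if t < T then 𝓝[>] t else 𝓝[<] t) ⊓ ae volume

/-- The filter of the (essential) limit `s-`, with the inner one-sided limit at the end point
`0`. -/
def leftLim (s : ℝ) : Filter ℝ := (if 0 < s then 𝓝[<] s else 𝓝[>] s) ⊓ ae volume

/-- `(v, ξ)` is an energy-variational solution on `(0,T)` with viscosity `ν`, right-hand side `f`
and initial value `v₀`. The values `R(v(t+) | u(t)) + ξ(t+)` and `R(v(s-) | u(s)) + ξ(s-)` are the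
one-sided limits `a` and `b` of the sum. -/
structure IsSolution {d : ℕ} (Ω : Set (Eu d)) (T ν : ℝ) (f : ℝ → Hm1 Ω × L2 Ω (Fin d))
    (v₀ : L2sol Ω) (v : ℝ → L2sol Ω) (ξ : ℝ → ℝ) : Prop where
  memX : MemX Ω T ν v
  memLp : MemLp ξ ⊤ (timeMeasure T)
  nonneg : ∀ t ∈ Ioo 0 T, 0 ≤ ξ t
  relative_energy : ∀ K : L2sol Ω → ℝ≥0∞, IsAdmissible Ω T ν K →
    ∀ u w, MemY Ω T ν u w → u ∈ KDomain Ω T ν K →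
    ∀ s t, 0 ≤ s → s ≤ t → t ≤ T →
    ∃ a b : ℝ,
      Tendsto (fun τ => relEnergy (v τ) (u t) + ξ τ) (rightLim T t) (𝓝 a) ∧
      Tendsto (fun τ => relEnergy (v τ) (u s) + ξ τ) (leftLim s) (𝓝 b) ∧
      a + ∫ τ in s..t, (relForm ν K (v τ) (u τ)
          + systemOp ν (f τ) (u τ) (w τ) ((v τ - u τ : L2sol Ω) : L2 Ω (Fin d))
          - (K (u τ)).toReal * (relEnergy (v τ) (u τ) + ξ τ)) ≤ b
  initial : ∀ c : L2sol Ω,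
    Tendsto (fun τ => inner ℝ (v τ) c) (𝓝[>] 0 ⊓ ae volume) (𝓝 (inner ℝ v₀ c))

end EnergyVariational

end

/-!
Let `φ` be a smooth solenoidal test field that vanishes at the times `q` and `r`. Testing the
relative energy inequality with `φ` and integrating the convective term by parts, the terms
containing `K` cancel wherever `ξ = 0`, and the integrand `W_ν + ⟨A_ν(φ), v - φ⟩ - K R` becomes the
rate of the energy balance of `v` minus the integrand of the weak formulation tested with `φ`, up
to the time derivative of `‖φ‖² / 2`, whose integral vanishes. For `φ = 0` this is the energy
inequality between the one-sided limits, which are the values of `‖v‖² / 2` at Lebesgue points. On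
the whole interval `(s, t)` the inequality holds for all multiples `c φ`; it is affine in `c`, so
the coefficient of `c`, which is the weak formulation, vanishes.

For this an admissible `K` has to exist. A multiple of the `W^{1,∞}` norm works: it dominates the
convective term once the latter is written with its derivative on the test field, and `D(K)` can
be given the topology induced by `u ↦ K(u) ∈ L¹(0, T)`.
-/

noncomputable section

namespace EnergyVariational

section WeakGradients

variable {d : ℕ} {Ω : Set (Eu d)} {F F' : Type} [NormedAddCommGroup F] [NormedSpace ℝ F]
  [NormedAddCommGroup F'] [NormedSpace ℝ F'] {ι : Type} [Fintype ι]

theorem IsTest.memLp {φ : Eu d → F} (hφ : IsTest Ω φ) (p : ℝ≥0∞) :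
    MemLp φ p (volume.restrict Ω) :=
  (hφ.1.continuous.memLp_of_hasCompactSupport hφ.2.1).restrict Ω

theorem IsTest.integrable {φ : Eu d → F} (hφ : IsTest Ω φ) : Integrable φ :=
  hφ.1.continuous.integrable_of_hasCompactSupport hφ.2.1

theorem IsTest.eq_zero_of_notMem {φ : Eu d → F} (hφ : IsTest Ω φ) {x : Eu d} (hx : x ∉ Ω) :
    φ x = 0 :=
  image_eq_zero_of_notMem_tsupport fun h => hx (hφ.2.2 h)

theorem IsTest.differentiableAt {φ : Eu d → F} (hφ : IsTest Ω φ) (x : Eu d) :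
    DifferentiableAt ℝ φ x :=
  hφ.1.differentiable (by simp) x

theorem IsTest.clm_comp {φ : Eu d → F} (hφ : IsTest Ω φ) (L : F →L[ℝ] F') :
    IsTest Ω (fun x => L (φ x)) :=
  ⟨L.contDiff.comp hφ.1, hφ.2.1.comp_left (map_zero L),
    (tsupport_comp_subset (map_zero L) φ).trans hφ.2.2⟩

theorem IsTest.fderiv {φ : Eu d → F} (hφ : IsTest Ω φ) : IsTest Ω (fderiv ℝ φ) :=
  ⟨hφ.1.fderiv_right (by simp), hφ.2.1.fderiv ℝ, (tsupport_fderiv_subset ℝ).trans hφ.2.2⟩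

theorem IsTest.fderiv_apply {φ : Eu d → F} (hφ : IsTest Ω φ) (e : Eu d) :
    IsTest Ω (fun x => _root_.fderiv ℝ φ x e) :=
  hφ.fderiv.clm_comp (ContinuousLinearMap.apply ℝ F e)

theorem IsTest.coord {φ : Eu d → EuclideanSpace ℝ ι} (hφ : IsTest Ω φ) (i : ι) :
    IsTest Ω (fun x => φ x i) :=
  hφ.clm_comp (EuclideanSpace.proj i)

theorem IsTest.mul {η ζ : Eu d → ℝ} (hη : IsTest Ω η) (hζ : IsTest Ω ζ) :
    IsTest Ω (fun x => η x * ζ x) :=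
  ⟨hη.1.mul hζ.1, hη.2.1.mul_right, tsupport_mul_subset_left.trans hη.2.2⟩

theorem IsTest.memLp_top_of_ae_eq {φ : Eu d → F} (hφ : IsTest Ω φ) {u : Eu d → F}
    (hu : u =ᵐ[volume.restrict Ω] φ) : MemLp u ⊤ (volume.restrict Ω) :=
  (memLp_congr_ae hu).2 (hφ.memLp ⊤)

theorem memLp_coord (u : L2 Ω ι) (i : ι) : MemLp (fun x => u x i) 2 (volume.restrict Ω) :=
  (EuclideanSpace.proj (𝕜 := ℝ) i).comp_memLp' (Lp.memLp u)

theorem integrableOn_coord_mul {η : Eu d → ℝ} (hη : MemLp η 2 (volume.restrict Ω))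
    (u : L2 Ω ι) (i : ι) : IntegrableOn (fun x => u x i * η x) Ω :=
  (memLp_coord u i).integrable_mul hη

/-- The bounded linear functional `u ↦ ∫_Ω uᵢ η dx` on `L²(Ω; ℝ^ι)`, through which the weak
gradient becomes a closed linear condition. -/
def coordPairing {η : Eu d → ℝ} (hη : MemLp η 2 (volume.restrict Ω)) (i : ι) :
    StrongDual ℝ (L2 Ω ι) :=
  innerSL ℝ (hη.toLp η) ∘L (EuclideanSpace.proj (𝕜 := ℝ) i).compLpL 2 (volume.restrict Ω)

theorem coordPairing_apply {η : Eu d → ℝ} (hη : MemLp η 2 (volume.restrict Ω)) (i : ι)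
    (u : L2 Ω ι) : coordPairing hη i u = ∫ x in Ω, u x i * η x := by
  calc coordPairing hη i u
      = inner ℝ (hη.toLp η)
          ((EuclideanSpace.proj (𝕜 := ℝ) i).compLpL 2 (volume.restrict Ω) u) := rfl
    _ = ∫ x in Ω, u x i * η x := by
        rw [L2.inner_def]
        refine integral_congr_ae ?_
        filter_upwards [hη.coeFn_toLp, (EuclideanSpace.proj (𝕜 := ℝ) i).coeFn_compLpL u]
          with x hηx hux
        rw [hηx, hux]
        rfl

/-- The graph of the weak gradient as a subspace of `L² × L²`. -/
def weakGradGraph (Ω : Set (Eu d)) (ι : Type) [Fintype ι] :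
    Submodule ℝ (L2 Ω ι × L2 Ω (ι × Fin d)) :=
  ⨅ (η : Eu d → ℝ) (hη : IsTest Ω η) (i : ι) (j : Fin d),
    (coordPairing ((hη.fderiv_apply (EuclideanSpace.single j 1)).memLp 2) i ∘L
        ContinuousLinearMap.fst ℝ _ _ +
      coordPairing (hη.memLp 2) (i, j) ∘L ContinuousLinearMap.snd ℝ _ _).ker

theorem mem_weakGradGraph {p : L2 Ω ι × L2 Ω (ι × Fin d)} :
    p ∈ weakGradGraph Ω ι ↔ IsWeakGrad Ω p.1 p.2 := by
  simp only [weakGradGraph, Submodule.mem_iInf, LinearMap.mem_ker, ContinuousLinearMap.coe_coe,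
    _root_.add_apply, ContinuousLinearMap.comp_apply, ContinuousLinearMap.coe_fst',
    ContinuousLinearMap.coe_snd', coordPairing_apply, add_eq_zero_iff_eq_neg, IsWeakGrad]

theorem isClosed_weakGradGraph :
    IsClosed (weakGradGraph Ω ι : Set (L2 Ω ι × L2 Ω (ι × Fin d))) := by
  simp only [weakGradGraph, Submodule.coe_iInf]
  exact isClosed_iInter fun η => isClosed_iInter fun hη => isClosed_iInter fun i =>
    isClosed_iInter fun j => ContinuousLinearMap.isClosed_ker _

theorem IsWeakGrad.sub {u u' : L2 Ω ι} {G G' : L2 Ω (ι × Fin d)} (h : IsWeakGrad Ω u G)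
    (h' : IsWeakGrad Ω u' G') : IsWeakGrad Ω (u - u') (G - G') :=
  mem_weakGradGraph.1 <|
    (weakGradGraph Ω ι).sub_mem (mem_weakGradGraph (p := (u, G)).2 h)
      (mem_weakGradGraph (p := (u', G')).2 h')

theorem IsWeakGrad.const_smul {u : L2 Ω ι} {G : L2 Ω (ι × Fin d)} (h : IsWeakGrad Ω u G) (c : ℝ) :
    IsWeakGrad Ω (c • u) (c • G) :=
  mem_weakGradGraph.1 <|
    (weakGradGraph Ω ι).smul_mem c (mem_weakGradGraph (p := (u, G)).2 h)

theorem isWeakGrad_zero : IsWeakGrad Ω (0 : L2 Ω ι) 0 :=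
  mem_weakGradGraph.1 (weakGradGraph Ω ι).zero_mem

theorem IsWeakGrad.eq_zero (hΩ : IsOpen Ω) {G : L2 Ω (ι × Fin d)}
    (h : IsWeakGrad Ω (0 : L2 Ω ι) G) : G = 0 := by
  have integral_eq_zero : ∀ η : Eu d → ℝ, IsTest Ω η → ∀ i j, ∫ x in Ω, G x (i, j) * η x = 0 := by
    intro η hη i j
    have := h η hη i j
    rwa [← coordPairing_apply ((hη.fderiv_apply _).memLp 2), map_zero, eq_comm,
      neg_eq_zero] at this
  have coord_eq_zero : ∀ p : ι × Fin d, ∀ᵐ x, x ∈ Ω → G x p = 0 := by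
    rintro ⟨i, j⟩
    refine hΩ.ae_eq_zero_of_integral_contDiff_smul_eq_zero ?_ fun g hg hgc hgs => ?_
    · have : LocallyIntegrable (fun x => G x (i, j)) (volume.restrict Ω) :=
        (memLp_coord G (i, j)).locallyIntegrable one_le_two
      exact locallyIntegrableOn_of_locallyIntegrable_restrict this
    · have hgΩ : IsTest Ω g := ⟨hg, hgc, hgs⟩
      rw [← integral_eq_zero g hgΩ i j, ← setIntegral_eq_integral_of_forall_compl_eq_zero (s := Ω)]
      · simp only [smul_eq_mul, mul_comm]
      · exact fun x hx => by rw [hgΩ.eq_zero_of_notMem hx, zero_smul]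
  refine (Lp.eq_zero_iff_ae_eq_zero).2 ?_
  rw [EventuallyEq, ae_restrict_iff' hΩ.measurableSet]
  filter_upwards [eventually_countable_forall.2 coord_eq_zero] with x hx hxΩ
  ext p
  exact hx p hxΩ

theorem IsWeakGrad.unique (hΩ : IsOpen Ω) {u : L2 Ω ι} {G G' : L2 Ω (ι × Fin d)}
    (h : IsWeakGrad Ω u G) (h' : IsWeakGrad Ω u G') : G = G' :=
  sub_eq_zero.1 <| IsWeakGrad.eq_zero hΩ <| by simpa only [sub_self] using h.sub h'

theorem IsWeakGrad.isWeakGrad_weakGrad {u : L2 Ω ι} {G : L2 Ω (ι × Fin d)}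
    (h : IsWeakGrad Ω u G) : IsWeakGrad Ω u (weakGrad Ω u) := by
  have hu : ∃ G, IsWeakGrad Ω u G := ⟨G, h⟩
  rw [weakGrad, dif_pos hu]
  exact hu.choose_spec

theorem IsWeakGrad.weakGrad_eq (hΩ : IsOpen Ω) {u : L2 Ω ι} {G : L2 Ω (ι × Fin d)}
    (h : IsWeakGrad Ω u G) : weakGrad Ω u = G :=
  h.isWeakGrad_weakGrad.unique hΩ h

theorem weakGrad_zero (hΩ : IsOpen Ω) : weakGrad Ω (0 : L2 Ω ι) = 0 :=
  isWeakGrad_zero.weakGrad_eq hΩ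

theorem weakGrad_const_smul (hΩ : IsOpen Ω) (c : ℝ) (u : L2 Ω ι) :
    weakGrad Ω (c • u) = c • weakGrad Ω u := by
  rcases eq_or_ne c 0 with rfl | hc
  · rw [zero_smul, zero_smul, weakGrad_zero hΩ]
  by_cases hu : ∃ G, IsWeakGrad Ω u G
  · obtain ⟨G, hG⟩ := hu
    exact (hG.isWeakGrad_weakGrad.const_smul c).weakGrad_eq hΩ
  · have hcu : ¬ ∃ G, IsWeakGrad Ω (c • u) G := by
      rintro ⟨G, hG⟩
      exact hu ⟨c⁻¹ • G, by simpa only [inv_smul_smul₀ hc] using hG.const_smul c⁻¹⟩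
    rw [weakGrad, weakGrad, dif_neg hu, dif_neg hcu, smul_zero]

/-- The matrix entries of a linear map `ℝᵈ → ℝ^ι`, the entry `(i, j)` being the `i`-th coordinate
of the image of the `j`-th basis vector. -/
def entries (d : ℕ) (ι : Type) [Fintype ι] :
    (Eu d →L[ℝ] EuclideanSpace ℝ ι) →L[ℝ] EuclideanSpace ℝ (ι × Fin d) :=
  (EuclideanSpace.equiv (ι × Fin d) ℝ).symm.toContinuousLinearMap ∘L
    ContinuousLinearMap.pi fun p : ι × Fin d =>
    EuclideanSpace.proj p.1 ∘L ContinuousLinearMap.apply ℝ _ (EuclideanSpace.single p.2 1)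

/-- The classical gradient of a map into `ℝ^ι`; the entry `(i, j)` is `∂ⱼ gᵢ`. Unlike `grad` it can
be iterated. -/
def jacobian (g : Eu d → EuclideanSpace ℝ ι) (x : Eu d) : EuclideanSpace ℝ (ι × Fin d) :=
  entries d ι (fderiv ℝ g x)

theorem grad_eq_jacobian (φ : Eu d → Eu d) : grad φ = jacobian φ := rfl

theorem IsTest.jacobian {g : Eu d → EuclideanSpace ℝ ι} (hg : IsTest Ω g) :
    IsTest Ω (jacobian g) :=
  hg.fderiv.clm_comp (entries d ι)

theorem fderiv_coord {g : Eu d → EuclideanSpace ℝ ι} {x : Eu d} (hg : DifferentiableAt ℝ g x)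
    (i : ι) (j : Fin d) :
    fderiv ℝ (fun y => g y i) x (EuclideanSpace.single j 1) = jacobian g x (i, j) :=
  congrArg (· (EuclideanSpace.single j 1))
    ((EuclideanSpace.proj (𝕜 := ℝ) i).hasFDerivAt.comp x hg.hasFDerivAt).fderiv

theorem IsTest.isWeakGrad_of_ae_eq {g : Eu d → EuclideanSpace ℝ ι}
    (hg : IsTest Ω g) {u : L2 Ω ι} {G : L2 Ω (ι × Fin d)} (hu : u =ᵐ[volume.restrict Ω] g)
    (hG : G =ᵐ[volume.restrict Ω] EnergyVariational.jacobian g) : IsWeakGrad Ω u G := by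
  intro η hη i j
  have hgi := hg.coord i
  have hgη := hgi.mul (hη.fderiv_apply (EuclideanSpace.single j 1))
  have hgη' := (hgi.fderiv_apply (EuclideanSpace.single j 1)).mul hη
  calc ∫ x in Ω, u x i * _root_.fderiv ℝ η x (EuclideanSpace.single j 1)
      = ∫ x in Ω, g x i * _root_.fderiv ℝ η x (EuclideanSpace.single j 1) := by
        refine integral_congr_ae ?_
        filter_upwards [hu] with x hx using by rw [hx]
    _ = ∫ x, g x i * _root_.fderiv ℝ η x (EuclideanSpace.single j 1) :=
        setIntegral_eq_integral_of_forall_compl_eq_zero fun _ hx => hgη.eq_zero_of_notMem hx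
    _ = -∫ x, _root_.fderiv ℝ (fun y => g y i) x (EuclideanSpace.single j 1) * η x :=
        integral_mul_fderiv_eq_neg_fderiv_mul_of_integrable hgη'.integrable hgη.integrable
          (hgi.mul hη).integrable (fun x _ => hgi.differentiableAt x)
          fun x _ => hη.differentiableAt x
    _ = -∫ x in Ω, _root_.fderiv ℝ (fun y => g y i) x (EuclideanSpace.single j 1) * η x := by
        rw [setIntegral_eq_integral_of_forall_compl_eq_zero fun _ hx =>
          hgη'.eq_zero_of_notMem hx]
    _ = -∫ x in Ω, G x (i, j) * η x := by
        congr 1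
        refine integral_congr_ae ?_
        filter_upwards [hG] with x hx
        rw [hx, fderiv_coord (hg.differentiableAt x)]

theorem IsTest.isWeakGrad_weakGrad {g : Eu d → EuclideanSpace ℝ ι} (hg : IsTest Ω g)
    {u : L2 Ω ι} (hu : u =ᵐ[volume.restrict Ω] g) : IsWeakGrad Ω u (weakGrad Ω u) :=
  (hg.isWeakGrad_of_ae_eq hu (hg.jacobian.memLp 2).coeFn_toLp).isWeakGrad_weakGrad

theorem IsTest.weakGrad_ae_eq (hΩ : IsOpen Ω) {g : Eu d → EuclideanSpace ℝ ι}
    (hg : IsTest Ω g) {u : L2 Ω ι} (hu : u =ᵐ[volume.restrict Ω] g) :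
    weakGrad Ω u =ᵐ[volume.restrict Ω] EnergyVariational.jacobian g := by
  have hG := (hg.jacobian.memLp 2).coeFn_toLp
  rwa [(hg.isWeakGrad_of_ae_eq hu hG).weakGrad_eq hΩ]

theorem IsWeakGrad.integral_sum_mul {u : L2 Ω ι} {G : L2 Ω (ι × Fin d)} (h : IsWeakGrad Ω u G)
    {η : ι → Fin d → Eu d → ℝ} (hη : ∀ i j, IsTest Ω (η i j)) :
    ∫ x in Ω, ∑ i, ∑ j, G x (i, j) * η i j x =
      -∫ x in Ω, ∑ i, ∑ j, u x i * fderiv ℝ (η i j) x (EuclideanSpace.single j 1) := by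
  have hG : ∀ i j, IntegrableOn (fun x => G x (i, j) * η i j x) Ω := fun i j =>
    integrableOn_coord_mul ((hη i j).memLp 2) G (i, j)
  have hu : ∀ i j, IntegrableOn
      (fun x => u x i * fderiv ℝ (η i j) x (EuclideanSpace.single j 1)) Ω := fun i j =>
    integrableOn_coord_mul (((hη i j).fderiv_apply _).memLp 2) u i
  rw [integral_finsetSum _ fun i _ => integrable_finsetSum _ fun j _ => hG i j,
    integral_finsetSum _ fun i _ => integrable_finsetSum _ fun j _ => hu i j,
    ← Finset.sum_neg_distrib]
  refine Finset.sum_congr rfl fun i _ => ?_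
  rw [integral_finsetSum _ fun j _ => hG i j, integral_finsetSum _ fun j _ => hu i j,
    ← Finset.sum_neg_distrib]
  refine Finset.sum_congr rfl fun j _ => ?_
  rw [h _ (hη i j) i j, neg_neg]

theorem H10sol_le_H10 : H10sol Ω ≤ H10 Ω :=
  Submodule.topologicalClosure_mono <| Submodule.span_mono fun _ ⟨φ, hφ, h⟩ => ⟨φ, hφ.1, h⟩

theorem isWeakGrad_of_mem_H10 {p : L2 Ω (Fin d) × L2 Ω (Fin d × Fin d)} (hp : p ∈ H10 Ω) :
    IsWeakGrad Ω p.1 p.2 := by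
  have : H10 Ω ≤ weakGradGraph Ω (Fin d) :=
    Submodule.topologicalClosure_minimal _
      (Submodule.span_le.2 fun _ ⟨_, hφ, hu, hG⟩ =>
        mem_weakGradGraph.2 (hφ.isWeakGrad_of_ae_eq hu hG))
      isClosed_weakGradGraph
  exact mem_weakGradGraph.1 (this hp)

end WeakGradients

section ConvectiveForm

variable {d : ℕ} {Ω : Set (Eu d)}

/-- The contraction `(G, c) ↦ Gᵀ c`, for which `(a · ∇) b · c = a · contract (∇b) c`; it turns the
trilinear form `convForm` into an `L²` inner product with a Hölder product. -/
def contract (d : ℕ) : EuclideanSpace ℝ (Fin d × Fin d) →L[ℝ] Eu d →L[ℝ] Eu d :=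
  (LinearMap.mk₂ ℝ (fun (G : EuclideanSpace ℝ (Fin d × Fin d)) (c : Eu d) =>
      (WithLp.toLp 2 fun j => ∑ i, G (i, j) * c i : Eu d))
    (by intros; ext j; simp [add_mul, Finset.sum_add_distrib])
    (by intros; ext j; simp [mul_assoc, Finset.mul_sum])
    (by intros; ext j; simp [mul_add, Finset.sum_add_distrib])
    (by intros; ext j; simp [mul_left_comm, Finset.mul_sum])).toContinuousBilinearMap

theorem inner_contract (a : Eu d) (G : EuclideanSpace ℝ (Fin d × Fin d)) (c : Eu d) :
    inner ℝ a (contract d G c) = ∑ i, ∑ j, a j * G (i, j) * c i := by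
  have contract_apply : ∀ j, contract d G c j = ∑ i, G (i, j) * c i := fun _ => rfl
  rw [PiLp.inner_apply, Finset.sum_comm]
  simp only [contract_apply, RCLike.inner_apply, conj_trivial, Finset.sum_mul]
  exact Finset.sum_congr rfl fun j _ => Finset.sum_congr rfl fun i _ => by ring

theorem convForm_eq_integral_inner (a : L2 Ω (Fin d)) (G : L2 Ω (Fin d × Fin d))
    (c : L2 Ω (Fin d)) :
    convForm a G c = ∫ x in Ω, inner ℝ (a x) (contract d (G x) (c x)) := by
  simp only [inner_contract, convForm]

theorem convForm_eq_inner_of_bdd_right {c : L2 Ω (Fin d)} {V : Lp (Eu d) ⊤ (volume.restrict Ω)}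
    (hV : V =ᵐ[volume.restrict Ω] c) (a : L2 Ω (Fin d)) (G : L2 Ω (Fin d × Fin d)) :
    convForm a G c = inner ℝ a ((contract d).flip.holder 2 V G) := by
  rw [convForm_eq_integral_inner, L2.inner_def]
  refine integral_congr_ae ?_
  filter_upwards [hV, (contract d).flip.coeFn_holder (r := 2) V G] with x hVx hx
  rw [hx, hVx, ContinuousLinearMap.flip_apply]

theorem convForm_eq_inner_of_bdd_mid {G : L2 Ω (Fin d × Fin d)}
    {D : Lp (EuclideanSpace ℝ (Fin d × Fin d)) ⊤ (volume.restrict Ω)}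
    (hD : D =ᵐ[volume.restrict Ω] G) (a c : L2 Ω (Fin d)) :
    convForm a G c = inner ℝ a ((contract d).holder 2 D c) := by
  rw [convForm_eq_integral_inner, L2.inner_def]
  refine integral_congr_ae ?_
  filter_upwards [hD, (contract d).coeFn_holder (r := 2) D c] with x hDx hx
  rw [hx, hDx]

theorem abs_convForm_le_of_bdd_mid {G : L2 Ω (Fin d × Fin d)}
    (hG : MemLp G ⊤ (volume.restrict Ω)) (a c : L2 Ω (Fin d)) :
    |convForm a G c| ≤ ‖contract d‖ * (eLpNorm G ⊤ (volume.restrict Ω)).toReal * ‖a‖ * ‖c‖ := by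
  have holder_le := (contract d).norm_holder_apply_apply_le (r := 2) hG.toLp c
  rw [Lp.norm_toLp] at holder_le
  rw [convForm_eq_inner_of_bdd_mid hG.coeFn_toLp]
  calc |inner ℝ a ((contract d).holder 2 hG.toLp c)|
      ≤ ‖a‖ * ‖(contract d).holder 2 hG.toLp c‖ := abs_real_inner_le_norm _ _
    _ ≤ ‖a‖ * (‖contract d‖ * (eLpNorm G ⊤ (volume.restrict Ω)).toReal * ‖c‖) := by gcongr
    _ = _ := by ring

theorem convForm_sub_left_of_bdd_right {c : L2 Ω (Fin d)} (hc : MemLp c ⊤ (volume.restrict Ω))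
    (a a' : L2 Ω (Fin d)) (G : L2 Ω (Fin d × Fin d)) :
    convForm (a - a') G c = convForm a G c - convForm a' G c := by
  simp only [convForm_eq_inner_of_bdd_right hc.coeFn_toLp, inner_sub_left]

theorem convForm_sub_left_of_bdd_mid {G : L2 Ω (Fin d × Fin d)}
    (hG : MemLp G ⊤ (volume.restrict Ω)) (a a' c : L2 Ω (Fin d)) :
    convForm (a - a') G c = convForm a G c - convForm a' G c := by
  simp only [convForm_eq_inner_of_bdd_mid hG.coeFn_toLp, inner_sub_left]

theorem convForm_sub_mid {c : L2 Ω (Fin d)} (hc : MemLp c ⊤ (volume.restrict Ω))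
    (a : L2 Ω (Fin d)) (G G' : L2 Ω (Fin d × Fin d)) :
    convForm a (G - G') c = convForm a G c - convForm a G' c := by
  simp only [convForm_eq_inner_of_bdd_right hc.coeFn_toLp,
    ← ContinuousLinearMap.holderL_apply_apply, map_sub, inner_sub_right]

theorem convForm_sub_right {G : L2 Ω (Fin d × Fin d)} (hG : MemLp G ⊤ (volume.restrict Ω))
    (a c c' : L2 Ω (Fin d)) :
    convForm a G (c - c') = convForm a G c - convForm a G c' := by
  simp only [convForm_eq_inner_of_bdd_mid hG.coeFn_toLp,
    ← ContinuousLinearMap.holderL_apply_apply, map_sub, inner_sub_right]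

theorem symForm_eq_convForm (a : L2 Ω (Fin d)) (G : L2 Ω (Fin d × Fin d)) :
    symForm a G = convForm a G a := by
  refine integral_congr_ae (.of_forall fun x => ?_)
  have swap : ∑ i, ∑ j, a x i * G x (j, i) * a x j = ∑ i, ∑ j, a x j * G x (i, j) * a x i :=
    Finset.sum_comm
  calc ∑ i, ∑ j, a x i * ((G x (i, j) + G x (j, i)) / 2) * a x j
      = ∑ i, ∑ j, (a x j * G x (i, j) * a x i / 2 + a x i * G x (j, i) * a x j / 2) :=
        Finset.sum_congr rfl fun i _ => Finset.sum_congr rfl fun j _ => by ring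
    _ = ∑ i, ∑ j, a x j * G x (i, j) * a x i := by
        simp only [Finset.sum_add_distrib, ← Finset.sum_div, swap, add_halves]

theorem IsSolTest.sum_fderiv_coord_mul {ψ : Eu d → Eu d} (hψ : IsSolTest Ω ψ) {φ : Eu d → ℝ}
    (hφ : IsTest Ω φ) (x : Eu d) :
    ∑ j, fderiv ℝ (fun y => ψ y j * φ y) x (EuclideanSpace.single j 1) =
      ∑ j, ψ x j * fderiv ℝ φ x (EuclideanSpace.single j 1) := by
  have diverg_eq_zero : ∑ j, jacobian ψ x (j, j) = 0 := hψ.2 x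
  have product_rule : ∀ j, fderiv ℝ (fun y => ψ y j * φ y) x (EuclideanSpace.single j 1) =
      ψ x j * fderiv ℝ φ x (EuclideanSpace.single j 1) + φ x * jacobian ψ x (j, j) := by
    intro j
    rw [fderiv_fun_mul ((hψ.1.coord j).differentiableAt x) (hφ.differentiableAt x),
      ← fderiv_coord (hψ.1.differentiableAt x)]
    rfl
  simp only [product_rule, Finset.sum_add_distrib, ← Finset.mul_sum, diverg_eq_zero, mul_zero,
    add_zero]

theorem convForm_eq_neg_of_isSolTest (hΩ : IsOpen Ω) {a : L2 Ω (Fin d)} {ψ : Eu d → Eu d}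
    (hψ : IsSolTest Ω ψ) (ha : a =ᵐ[volume.restrict Ω] ψ)
    {b : L2 Ω (Fin d)} {G : L2 Ω (Fin d × Fin d)} (hb : IsWeakGrad Ω b G)
    {U : L2 Ω (Fin d)} {φ : Eu d → Eu d} (hφ : IsTest Ω φ) (hU : U =ᵐ[volume.restrict Ω] φ) :
    convForm a G U = - convForm a (weakGrad Ω U) b := by
  calc convForm a G U
      = ∫ x in Ω, ∑ i, ∑ j, G x (i, j) * (ψ x j * φ x i) := by
        refine integral_congr_ae ?_
        filter_upwards [ha, hU] with x ha hU
        rw [ha, hU]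
        exact Finset.sum_congr rfl fun i _ => Finset.sum_congr rfl fun j _ => by ring
    _ = -∫ x in Ω, ∑ i, ∑ j, b x i *
          fderiv ℝ (fun y => ψ y j * φ y i) x (EuclideanSpace.single j 1) :=
        hb.integral_sum_mul fun i j => (hψ.1.coord j).mul (hφ.coord i)
    _ = -convForm a (weakGrad Ω U) b := by
        congr 1
        refine integral_congr_ae ?_
        filter_upwards [ha, hφ.weakGrad_ae_eq hΩ hU] with x ha hU
        refine Finset.sum_congr rfl fun i _ => ?_
        rw [← Finset.mul_sum, hψ.sum_fderiv_coord_mul (hφ.coord i), ha, hU, Finset.mul_sum]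
        refine Finset.sum_congr rfl fun j _ => ?_
        rw [fderiv_coord (hφ.differentiableAt x)]
        ring

theorem convForm_eq_neg (hΩ : IsOpen Ω) {a : L2 Ω (Fin d)} (ha : a ∈ L2sol Ω)
    {b : L2 Ω (Fin d)} {G : L2 Ω (Fin d × Fin d)} (hb : IsWeakGrad Ω b G)
    {U : L2 Ω (Fin d)} {φ : Eu d → Eu d} (hφ : IsTest Ω φ) (hU : U =ᵐ[volume.restrict Ω] φ) :
    convForm a G U = - convForm a (weakGrad Ω U) b := by
  have hU_top := hφ.memLp_top_of_ae_eq hU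
  have hDU_top := hφ.jacobian.memLp_top_of_ae_eq (hφ.weakGrad_ae_eq hΩ hU)
  set h : L2 Ω (Fin d) := (contract d).flip.holder 2 hU_top.toLp G
    + (contract d).holder 2 hDU_top.toLp b with hh
  have inner_eq : ∀ a : L2 Ω (Fin d),
      inner ℝ a h = convForm a G U + convForm a (weakGrad Ω U) b := fun a => by
    rw [hh, inner_add_right, ← convForm_eq_inner_of_bdd_right hU_top.coeFn_toLp,
      ← convForm_eq_inner_of_bdd_mid hDU_top.coeFn_toLp]
  have orthogonal : L2sol Ω ≤ (ℝ ∙ h)ᗮ := by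
    refine Submodule.topologicalClosure_minimal _ (Submodule.span_le.2 ?_)
      (Submodule.isClosed_orthogonal _)
    rintro a ⟨ψ, hψ, ha⟩
    rw [SetLike.mem_coe, Submodule.mem_orthogonal_singleton_iff_inner_left, inner_eq,
      convForm_eq_neg_of_isSolTest hΩ hψ ha hb hφ hU, neg_add_cancel]
  have := Submodule.mem_orthogonal_singleton_iff_inner_left.1 (orthogonal ha)
  rwa [inner_eq, add_eq_zero_iff_eq_neg] at this

theorem convForm_eq_neg_of_bdd (hΩ : IsOpen Ω) {a : L2 Ω (Fin d)} (ha : a ∈ L2sol Ω)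
    {b : L2 Ω (Fin d)} {G : L2 Ω (Fin d × Fin d)} (hbG : (b, G) ∈ H10 Ω)
    {c : L2 Ω (Fin d)} {D : L2 Ω (Fin d × Fin d)} (hcD : IsWeakGrad Ω c D)
    (hc : MemLp c ⊤ (volume.restrict Ω)) (hD : MemLp D ⊤ (volume.restrict Ω)) :
    convForm a G c = - convForm a D b := by
  let L : L2 Ω (Fin d) × L2 Ω (Fin d × Fin d) →L[ℝ] ℝ :=
    (innerSL ℝ a) ∘L ((contract d).flip.holderL (volume.restrict Ω) ⊤ 2 2 hc.toLp ∘L .snd ℝ _ _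
      + (contract d).holderL (volume.restrict Ω) ⊤ 2 2 hD.toLp ∘L .fst ℝ _ _)
  have L_apply : ∀ p, L p = convForm a p.2 c + convForm a D p.1 := fun p => by
    rw [convForm_eq_inner_of_bdd_right hc.coeFn_toLp, convForm_eq_inner_of_bdd_mid hD.coeFn_toLp,
      ← inner_add_right]
    rfl
  have H10_le_ker : H10 Ω ≤ LinearMap.ker (L : _ →ₗ[ℝ] ℝ) := by
    refine Submodule.topologicalClosure_minimal _ (Submodule.span_le.2 ?_) L.isClosed_ker
    rintro p ⟨φ, hφ, hp, hDp⟩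
    have grad_eq : p.2 = weakGrad Ω p.1 := Lp.ext (hDp.trans (hφ.weakGrad_ae_eq hΩ hp).symm)
    change L p = 0
    rw [L_apply, convForm_eq_neg hΩ ha hcD hφ hp, grad_eq, add_neg_cancel]
  have L_eq_zero : L (b, G) = 0 := H10_le_ker hbG
  rwa [L_apply, add_eq_zero_iff_eq_neg] at L_eq_zero

theorem laplaceForm_eq_neg_inner (hΩ : IsOpen Ω) {U : L2 Ω (Fin d)} {φ : Eu d → Eu d}
    (hφ : IsTest Ω φ) (hU : U =ᵐ[volume.restrict Ω] φ) {c : L2 Ω (Fin d)}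
    {G : L2 Ω (Fin d × Fin d)} (hc : IsWeakGrad Ω c G) :
    laplaceForm U c = - inner ℝ G (weakGrad Ω U) := by
  have hDU := hφ.weakGrad_ae_eq hΩ hU
  have hD2U := hφ.jacobian.weakGrad_ae_eq hΩ hDU
  calc laplaceForm U c
      = ∫ x in Ω, ∑ i, ∑ j,
          c x i * fderiv ℝ (fun y => jacobian φ y (i, j)) x (EuclideanSpace.single j 1) := by
        refine integral_congr_ae ?_
        filter_upwards [hD2U] with x hx
        refine Finset.sum_congr rfl fun i _ => Finset.sum_congr rfl fun j _ => ?_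
        rw [hx, fderiv_coord (hφ.jacobian.differentiableAt x), mul_comm]
    _ = -∫ x in Ω, ∑ i, ∑ j, G x (i, j) * jacobian φ x (i, j) := by
        rw [hc.integral_sum_mul fun i j => hφ.jacobian.coord (i, j), neg_neg]
    _ = -inner ℝ G (weakGrad Ω U) := by
        rw [L2.inner_def]
        congr 1
        refine integral_congr_ae ?_
        filter_upwards [hDU] with x hx
        simp only [hx, PiLp.inner_apply, Fintype.sum_prod_type, RCLike.inner_apply, conj_trivial,
          mul_comm]

end ConvectiveForm

section CompactlySupportedFamilies

variable {X E : Type*} [TopologicalSpace X] [NormedAddCommGroup E] {C : Set X}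

theorem eventually_forall_norm_sub_le {Y : Type*} [TopologicalSpace Y] {g : Y → X → E}
    (hg : Continuous g.uncurry) (hC : IsCompact C) (y : Y) {ε : ℝ} (hε : 0 < ε) :
    ∀ᶠ z in 𝓝 y, ∀ x ∈ C, ‖g z x - g y x‖ ≤ ε := by
  obtain ⟨v, hv, h⟩ := hC.mem_uniformity_of_prod (s := univ) hg.continuousOn (mem_univ y)
    (Metric.dist_mem_uniformity hε)
  rw [nhdsWithin_univ] at hv
  filter_upwards [hv] with z hz x hx
  exact dist_eq_norm (g z x) _ ▸ (h z hz x hx).le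

theorem continuous_uncurry_of_hasDerivAt [NormedSpace ℝ E] [CompleteSpace E]
    {g g' : ℝ → X → E}
    (hg : Continuous (g 0)) (hderiv : ∀ τ x, HasDerivAt (g · x) (g' τ x) τ)
    (hg' : Continuous g'.uncurry) : Continuous g.uncurry := by
  have eq_add_integral : g.uncurry = fun q => g 0 q.2 + ∫ σ in (0 : ℝ)..q.1, g' σ q.2 := by
    ext ⟨τ, x⟩
    rw [intervalIntegral.integral_eq_sub_of_hasDerivAt (fun σ _ => hderiv σ x)
      ((hg'.comp (Continuous.prodMk_left x)).intervalIntegrable 0 τ), add_sub_cancel]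
    rfl
  rw [eq_add_integral]
  have integrand_continuous : Continuous fun q : (ℝ × X) × ℝ => g'.uncurry (q.2, q.1.2) := by
    fun_prop
  exact (hg.comp continuous_snd).add <|
    intervalIntegral.continuous_parametric_intervalIntegral_of_continuous integrand_continuous
      continuous_fst

variable [T2Space X] [MeasurableSpace X] [OpensMeasurableSpace X] {μ : Measure X}
  [IsFiniteMeasureOnCompacts μ] {p : ℝ≥0∞}

theorem norm_le_of_ae_eq_of_support_subset (hC : IsCompact C) {u : Lp E p μ} {g : X → E}
    (hu : u =ᵐ[μ] g) (hsupp : ∀ x ∉ C, g x = 0) {c : ℝ} (hc : 0 ≤ c) (hbound : ∀ x ∈ C, ‖g x‖ ≤ c) :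
    ‖u‖ ≤ μ.real C ^ p.toReal⁻¹ * c := by
  have eLpNorm_le : eLpNorm u p μ ≤ μ C ^ p.toReal⁻¹ * ENNReal.ofReal c := by
    have hg_indicator : C.indicator g = g := indicator_eq_self.2 <|
      Function.support_subset_iff'.2 hsupp
    rw [eLpNorm_congr_ae hu, ← hg_indicator, eLpNorm_indicator_eq_eLpNorm_restrict hC.measurableSet]
    refine (eLpNorm_le_of_ae_bound ((ae_restrict_iff' hC.measurableSet).2 <|
      .of_forall hbound)).trans_eq ?_
    rw [Measure.restrict_apply_univ]
  rw [Lp.norm_def]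
  refine (ENNReal.toReal_mono ?_ eLpNorm_le).trans_eq ?_
  · finiteness [hC.measure_ne_top (μ := μ)]
  · rw [ENNReal.toReal_mul, ENNReal.toReal_ofReal hc, ← ENNReal.toReal_rpow, measureReal_def]

theorem continuous_Lp_of_ae_eq [Fact (1 ≤ p)] {Y : Type*} [TopologicalSpace Y] {g : Y → X → E}
    (hC : IsCompact C) (hsupp : ∀ y, ∀ x ∉ C, g y x = 0) (hg : Continuous g.uncurry)
    {u : Y → Lp E p μ} (hu : ∀ y, u y =ᵐ[μ] g y) : Continuous u := by
  refine continuous_iff_continuousAt.2 fun y => Metric.tendsto_nhds.2 fun ε hε => ?_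
  obtain ⟨δ, hδ, hδε⟩ := exists_pos_mul_lt hε (μ.real C ^ p.toReal⁻¹)
  filter_upwards [eventually_forall_norm_sub_le hg hC y hδ] with z hz
  rw [dist_eq_norm]
  refine (norm_le_of_ae_eq_of_support_subset hC ((Lp.coeFn_sub _ _).trans ((hu z).sub (hu y)))
    (fun x hx => ?_) hδ.le hz).trans_lt hδε
  rw [Pi.sub_apply, hsupp z x hx, hsupp y x hx, sub_zero]

variable [NormedSpace ℝ E]

theorem hasDerivAt_Lp_of_ae_eq [Fact (1 ≤ p)] {g g' : ℝ → X → E} (hC : IsCompact C)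
    (hsupp : ∀ τ, ∀ x ∉ C, g τ x = 0) (hderiv : ∀ τ x, HasDerivAt (g · x) (g' τ x) τ)
    (hg' : Continuous g'.uncurry) {u u' : ℝ → Lp E p μ} (hu : ∀ τ, u τ =ᵐ[μ] g τ)
    (hu' : ∀ τ, u' τ =ᵐ[μ] g' τ) (τ : ℝ) : HasDerivAt u (u' τ) τ := by
  have hsupp' : ∀ x ∉ C, g' τ x = 0 := fun x hx =>
    (hderiv τ x).unique <| by simpa only [hsupp _ x hx] using hasDerivAt_const τ (0 : E)
  refine hasDerivAt_iff_isLittleO.2 (Asymptotics.IsLittleO.of_bound fun ε hε => ?_)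
  obtain ⟨δ, hδ, hδε⟩ := exists_pos_mul_lt hε (μ.real C ^ p.toReal⁻¹)
  obtain ⟨r, hr, hball⟩ :=
    Metric.eventually_nhds_iff_ball.1 (eventually_forall_norm_sub_le hg' hC τ hδ)
  filter_upwards [Metric.ball_mem_nhds τ hr] with σ hσ
  have remainder_le : ∀ x ∈ C, ‖g σ x - g τ x - (σ - τ) • g' τ x‖ ≤ δ * ‖σ - τ‖ := by
    intro x hx
    have := (convex_ball τ r).norm_image_sub_le_of_norm_hasDerivWithin_le
      (f := fun ρ => g ρ x - ρ • g' τ x) (f' := fun ρ => g' ρ x - g' τ x)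
      (fun ρ _ => ((hderiv ρ x).sub <| by
        simpa only [one_smul, id] using (hasDerivAt_id ρ).smul_const (g' τ x)).hasDerivWithinAt)
      (fun ρ hρ => hball ρ hρ x hx) (Metric.mem_ball_self hr) hσ
    convert this using 2
    module
  have remainder_ae_eq : (u σ - u τ - (σ - τ) • u' τ : Lp E p μ) =ᵐ[μ]
      fun x => g σ x - g τ x - (σ - τ) • g' τ x :=
    (Lp.coeFn_sub _ _).trans <| ((Lp.coeFn_sub _ _).trans ((hu σ).sub (hu τ))).sub <|
      (Lp.coeFn_smul _ _).trans ((hu' τ).const_smul _)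
  refine (norm_le_of_ae_eq_of_support_subset hC remainder_ae_eq (fun x hx => ?_) (by positivity)
    remainder_le).trans ?_
  · simp only [hsupp _ x hx, hsupp' x hx, sub_zero, smul_zero]
  · rw [← mul_assoc]
    gcongr

end CompactlySupportedFamilies

section Curves

variable {d : ℕ} {Ω : Set (Eu d)}

theorem memLp_timeMeasure_of_continuous {E : Type*} [NormedAddCommGroup E] {g : ℝ → E}
    (hg : Continuous g) (T : ℝ) (p : ℝ≥0∞) : MemLp g p (timeMeasure T) := by
  obtain ⟨M, hM⟩ := (isCompact_Icc (a := (0 : ℝ)) (b := T)).exists_bound_of_continuousOn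
    hg.continuousOn
  refine MemLp.of_bound hg.aestronglyMeasurable M ?_
  filter_upwards [ae_restrict_mem measurableSet_Ioo] with τ hτ
  exact hM τ (Ioo_subset_Icc_self hτ)

theorem toL2_ae_eq {φ : Eu d → Eu d} (hφ : IsTest Ω φ) :
    toL2 Ω φ =ᵐ[volume.restrict Ω] φ := by
  rw [toL2, dif_pos (hφ.memLp 2)]
  exact (hφ.memLp 2).coeFn_toLp

theorem toL2_smul (c : ℝ) {φ : Eu d → Eu d} (hφ : IsTest Ω φ) :
    toL2 Ω (fun x => c • φ x) = c • toL2 Ω φ := by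
  rw [toL2, toL2, dif_pos (hφ.memLp 2)]
  exact dif_pos ((hφ.memLp 2).const_smul c)

theorem IsSolTest.toL2_mem_L2sol {φ : Eu d → Eu d} (hφ : IsSolTest Ω φ) : toL2 Ω φ ∈ L2sol Ω :=
  Submodule.le_topologicalClosure _ (Submodule.subset_span ⟨φ, hφ, toL2_ae_eq hφ.1⟩)

theorem IsSolTest.mem_H10sol (hΩ : IsOpen Ω) {φ : Eu d → Eu d} (hφ : IsSolTest Ω φ) :
    (toL2 Ω φ, weakGrad Ω (toL2 Ω φ)) ∈ H10sol Ω :=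
  Submodule.le_topologicalClosure _ <| Submodule.subset_span
    ⟨φ, hφ, toL2_ae_eq hφ.1, hφ.1.weakGrad_ae_eq hΩ (toL2_ae_eq hφ.1)⟩

instance completeSpace_L2sol : CompleteSpace (L2sol Ω) :=
  (Submodule.isClosed_topologicalClosure _).completeSpace_coe

theorem exists_clm_jacobian (d : ℕ) :
    ∃ L : (Eu d [×1]→L[ℝ] Eu d) →L[ℝ] EuclideanSpace ℝ (Fin d × Fin d),
      ∀ (g : Eu d → Eu d) (x : Eu d), jacobian g x = L (iteratedFDeriv ℝ 1 g x) :=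
  ⟨entries d (Fin d) ∘L (continuousMultilinearCurryFin1 ℝ (Eu d)
      (Eu d)).toContinuousLinearEquiv.toContinuousLinearMap,
    fun g x => congrArg (entries d (Fin d)) <| by
      ext1 y
      exact (iteratedFDeriv_one_apply (𝕜 := ℝ) (f := g) (x := x) (Fin.snoc 0 y)).symm⟩

theorem exists_clm_jacobian_jacobian (d : ℕ) :
    ∃ L : (Eu d [×2]→L[ℝ] Eu d) →L[ℝ] EuclideanSpace ℝ ((Fin d × Fin d) × Fin d),
      ∀ (g : Eu d → Eu d) (x : Eu d), ContDiff ℝ 2 g →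
        jacobian (jacobian g) x = L (iteratedFDeriv ℝ 2 g x) := by
  obtain ⟨L, hL⟩ := exists_clm_jacobian d
  refine ⟨entries d (Fin d × Fin d) ∘L ContinuousLinearMap.compL ℝ (Eu d) _ _ L ∘L
    (continuousMultilinearCurryLeftEquiv ℝ (fun _ : Fin 2 => Eu d)
      (Eu d)).toContinuousLinearEquiv.toContinuousLinearMap, fun g x hg => ?_⟩
  have jacobian_eq : jacobian g = L ∘ iteratedFDeriv ℝ 1 g := funext (hL g)
  have hg' : DifferentiableAt ℝ (iteratedFDeriv ℝ 1 g) x :=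
    hg.differentiable_iteratedFDeriv (by norm_cast) x
  rw [jacobian, jacobian_eq, (L.hasFDerivAt.comp x hg'.hasFDerivAt).fderiv,
    fderiv_iteratedFDeriv]
  rfl

namespace IsC1Sol

variable {φ : ℝ → Eu d → Eu d}

theorem exists_isTest (hφ : IsC1Sol Ω φ) : ∃ C, IsCompact C ∧ C ⊆ Ω ∧
    (∀ τ, IsTest C (φ τ)) ∧ ∀ τ, IsTest C (timeDeriv φ τ) := by
  obtain ⟨C, hC, hCΩ, hφC⟩ := hφ.support
  have isTest_of_vanishing : ∀ g : Eu d → Eu d, ContDiff ℝ ∞ g → (∀ x ∉ C, g x = 0) → IsTest C g :=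
    fun g hg hgC => ⟨hg, .of_support_subset_isCompact hC (Function.support_subset_iff'.2 hgC),
      closure_minimal (Function.support_subset_iff'.2 hgC) hC.isClosed⟩
  refine ⟨C, hC, hCΩ, fun τ => isTest_of_vanishing _ (hφ.smooth τ) (hφC τ),
    fun τ => isTest_of_vanishing _ (hφ.smooth_timeDeriv τ) fun x hx => ?_⟩
  simp only [timeDeriv, hφC _ x hx, deriv_const]

theorem isSolTest (hφ : IsC1Sol Ω φ) (τ : ℝ) : IsSolTest Ω (φ τ) := by
  obtain ⟨C, -, hCΩ, h, -⟩ := hφ.exists_isTest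
  exact ⟨⟨(h τ).1, (h τ).2.1, (h τ).2.2.trans hCΩ⟩, hφ.solenoidal τ⟩

theorem hasDerivAt_apply (hφ : IsC1Sol Ω φ) (τ : ℝ) (x : Eu d) :
    HasDerivAt (fun σ => φ σ x) (timeDeriv φ τ x) τ :=
  (continuousMultilinearCurryFin0 ℝ (Eu d)
    (Eu d)).toContinuousLinearEquiv.toContinuousLinearMap.hasFDerivAt.comp_hasDerivAt τ
      (hφ.hasDerivAt 0 τ x)

theorem continuous_timeDeriv (hφ : IsC1Sol Ω φ) : Continuous (timeDeriv φ).uncurry :=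
  (continuousMultilinearCurryFin0 ℝ (Eu d) (Eu d)).continuous.comp (hφ.continuous 0)

theorem continuous_iteratedFDeriv (hφ : IsC1Sol Ω φ) (n : ℕ) :
    Continuous fun p : ℝ × Eu d => iteratedFDeriv ℝ n (φ p.1) p.2 :=
  continuous_uncurry_of_hasDerivAt (g := fun τ => iteratedFDeriv ℝ n (φ τ))
    (g' := fun τ => iteratedFDeriv ℝ n (timeDeriv φ τ))
    ((contDiff_infty.1 (hφ.smooth 0) n).continuous_iteratedFDeriv le_rfl) (hφ.hasDerivAt n)
    (hφ.continuous n)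

theorem continuous_uncurry (hφ : IsC1Sol Ω φ) : Continuous φ.uncurry :=
  (continuousMultilinearCurryFin0 ℝ (Eu d) (Eu d)).continuous.comp (hφ.continuous_iteratedFDeriv 0)

theorem continuous_jacobian (hφ : IsC1Sol Ω φ) :
    Continuous (Function.uncurry fun τ => jacobian (φ τ)) := by
  obtain ⟨L, hL⟩ := exists_clm_jacobian d
  exact (L.continuous.comp (hφ.continuous_iteratedFDeriv 1)).congr fun p => (hL _ _).symm

theorem continuous_jacobian_jacobian (hφ : IsC1Sol Ω φ) :
    Continuous (Function.uncurry fun τ => jacobian (jacobian (φ τ))) := by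
  obtain ⟨L, hL⟩ := exists_clm_jacobian_jacobian d
  exact (L.continuous.comp (hφ.continuous_iteratedFDeriv 2)).congr fun p =>
    (hL _ _ (contDiff_infty.1 (hφ.smooth p.1) 2)).symm

theorem isSolTest_timeDeriv (hφ : IsC1Sol Ω φ) (τ : ℝ) : IsSolTest Ω (timeDeriv φ τ) := by
  obtain ⟨C, -, hCΩ, -, h⟩ := hφ.exists_isTest
  obtain ⟨L, hL⟩ := exists_clm_jacobian d
  refine ⟨⟨(h τ).1, (h τ).2.1, (h τ).2.2.trans hCΩ⟩, fun x => ?_⟩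
  have hasDerivAt_jacobian :
      HasDerivAt (fun σ => grad (φ σ) x) (grad (timeDeriv φ τ) x) τ := by
    simp only [grad_eq_jacobian, hL]
    exact L.hasFDerivAt.comp_hasDerivAt τ (hφ.hasDerivAt 1 τ x)
  have hasDerivAt_diverg : HasDerivAt (fun σ => diverg (φ σ) x) (diverg (timeDeriv φ τ) x) τ :=
    HasDerivAt.fun_sum fun i _ =>
      (EuclideanSpace.proj (𝕜 := ℝ) (i, i)).hasFDerivAt.comp_hasDerivAt τ hasDerivAt_jacobian
  simp only [hφ.solenoidal] at hasDerivAt_diverg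
  exact hasDerivAt_diverg.unique (hasDerivAt_const τ 0)

theorem time_smul (hφ : IsC1Sol Ω φ) {θ θ' : ℝ → ℝ} (hθ : ∀ τ, HasDerivAt θ (θ' τ) τ)
    (hθ' : Continuous θ') : IsC1Sol Ω (fun τ x => θ τ • φ τ x) := by
  have timeDeriv_eq : timeDeriv (fun τ x => θ τ • φ τ x) =
      fun τ x => θ τ • timeDeriv φ τ x + θ' τ • φ τ x := by
    ext1 τ
    ext1 x
    exact ((hθ τ).smul (hφ.hasDerivAt_apply τ x)).deriv
  have iteratedFDeriv_smul_eq : ∀ (n : ℕ) (τ : ℝ) (x : Eu d),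
      iteratedFDeriv ℝ n (fun y => θ τ • φ τ y) x = θ τ • iteratedFDeriv ℝ n (φ τ) x :=
    fun n τ x => iteratedFDeriv_const_smul_apply' (contDiff_infty.1 (hφ.smooth τ) n).contDiffAt
  have iteratedFDeriv_timeDeriv_eq : ∀ (n : ℕ) (τ : ℝ) (x : Eu d),
      iteratedFDeriv ℝ n (fun y => θ τ • timeDeriv φ τ y + θ' τ • φ τ y) x =
        θ τ • iteratedFDeriv ℝ n (timeDeriv φ τ) x + θ' τ • iteratedFDeriv ℝ n (φ τ) x := by
    intro n τ x
    have h := (contDiff_infty.1 (hφ.smooth τ) n).contDiffAt (x := x)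
    have h' := (contDiff_infty.1 (hφ.smooth_timeDeriv τ) n).contDiffAt (x := x)
    rw [fun_iteratedFDeriv_add_apply (h'.const_smul _) (h.const_smul _),
      iteratedFDeriv_const_smul_apply' h, iteratedFDeriv_const_smul_apply' h']
  have hθ_cont : Continuous θ := continuous_iff_continuousAt.2 fun τ => (hθ τ).continuousAt
  obtain ⟨C, hC, hCΩ, hφC⟩ := hφ.support
  refine ⟨⟨C, hC, hCΩ, fun τ x hx => by rw [hφC τ x hx, smul_zero]⟩,
    fun τ => (hφ.smooth τ).const_smul (θ τ), fun τ x => ?_, ?_, ?_, ?_⟩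
  · have := fderiv_fun_const_smul ((hφ.smooth τ).differentiable (by simp) x) (θ τ)
    simp only [diverg, grad_eq_jacobian, jacobian, this, map_smul, PiLp.smul_apply,
      ← Finset.smul_sum]
    exact smul_eq_zero_of_right _ (hφ.solenoidal τ x)
  · rw [timeDeriv_eq]
    exact fun τ => ((hφ.smooth_timeDeriv τ).const_smul _).add ((hφ.smooth τ).const_smul _)
  · simp only [timeDeriv_eq, iteratedFDeriv_smul_eq, iteratedFDeriv_timeDeriv_eq]
    exact fun n τ x => (hθ τ).smul (hφ.hasDerivAt n τ x)
  · simp only [timeDeriv_eq, iteratedFDeriv_timeDeriv_eq]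
    exact fun n => ((hθ_cont.comp continuous_fst).smul (hφ.continuous n)).add
      ((hθ'.comp continuous_fst).smul (hφ.continuous_iteratedFDeriv n))

theorem const_smul (hφ : IsC1Sol Ω φ) (c : ℝ) : IsC1Sol Ω (fun τ x => c • φ τ x) :=
  hφ.time_smul (fun τ => hasDerivAt_const τ c) continuous_const

/-- The curve in `L²_σ` given by a family of smooth fields. -/
def curve (hφ : IsC1Sol Ω φ) (τ : ℝ) : L2sol Ω := ⟨toL2 Ω (φ τ), (hφ.isSolTest τ).toL2_mem_L2sol⟩

/-- The time derivative of `IsC1Sol.curve`, that is, the curve given by `∂ₜφ`. -/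
def velocity (hφ : IsC1Sol Ω φ) (τ : ℝ) : L2sol Ω :=
  ⟨toL2 Ω (timeDeriv φ τ), (hφ.isSolTest_timeDeriv τ).toL2_mem_L2sol⟩

theorem curve_ae_eq (hφ : IsC1Sol Ω φ) (τ : ℝ) :
    (hφ.curve τ : L2 Ω (Fin d)) =ᵐ[volume.restrict Ω] φ τ :=
  toL2_ae_eq (hφ.isSolTest τ).1

theorem velocity_ae_eq (hφ : IsC1Sol Ω φ) (τ : ℝ) :
    (hφ.velocity τ : L2 Ω (Fin d)) =ᵐ[volume.restrict Ω] timeDeriv φ τ :=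
  toL2_ae_eq (hφ.isSolTest_timeDeriv τ).1

theorem curve_time_smul (hφ : IsC1Sol Ω φ) {θ : ℝ → ℝ} (h : IsC1Sol Ω fun τ x => θ τ • φ τ x)
    (τ : ℝ) : h.curve τ = θ τ • hφ.curve τ :=
  Subtype.ext (toL2_smul (θ τ) (hφ.isSolTest τ).1)

theorem velocity_const_smul (hφ : IsC1Sol Ω φ) (c τ : ℝ) :
    (hφ.const_smul c).velocity τ = c • hφ.velocity τ := by
  refine Subtype.ext ?_
  have timeDeriv_eq : timeDeriv (fun τ x => c • φ τ x) τ = fun x => c • timeDeriv φ τ x :=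
    funext fun x => ((hφ.hasDerivAt_apply τ x).const_smul c).deriv
  change toL2 Ω (timeDeriv (fun τ x => c • φ τ x) τ) = c • toL2 Ω (timeDeriv φ τ)
  rw [timeDeriv_eq, toL2_smul c (hφ.isSolTest_timeDeriv τ).1]

theorem weakGrad_curve_ae_eq (hΩ : IsOpen Ω) (hφ : IsC1Sol Ω φ) (τ : ℝ) :
    weakGrad Ω (hφ.curve τ : L2 Ω (Fin d)) =ᵐ[volume.restrict Ω] jacobian (φ τ) :=
  (hφ.isSolTest τ).1.weakGrad_ae_eq hΩ (hφ.curve_ae_eq τ)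

theorem memLp_top_curve (hφ : IsC1Sol Ω φ) (τ : ℝ) :
    MemLp (hφ.curve τ : L2 Ω (Fin d)) ⊤ (volume.restrict Ω) :=
  (hφ.isSolTest τ).1.memLp_top_of_ae_eq (hφ.curve_ae_eq τ)

theorem memLp_top_weakGrad_curve (hΩ : IsOpen Ω) (hφ : IsC1Sol Ω φ) (τ : ℝ) :
    MemLp (weakGrad Ω (hφ.curve τ : L2 Ω (Fin d))) ⊤ (volume.restrict Ω) :=
  (hφ.isSolTest τ).1.jacobian.memLp_top_of_ae_eq (hφ.weakGrad_curve_ae_eq hΩ τ)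

theorem continuous_velocity (hφ : IsC1Sol Ω φ) : Continuous hφ.velocity := by
  obtain ⟨C, hC, -, -, hφC⟩ := hφ.exists_isTest
  exact continuous_induced_rng.2 <| continuous_Lp_of_ae_eq hC
    (fun τ x => (hφC τ).eq_zero_of_notMem) hφ.continuous_timeDeriv hφ.velocity_ae_eq

theorem hasDerivAt_curve (hφ : IsC1Sol Ω φ) (τ : ℝ) :
    HasDerivAt hφ.curve (hφ.velocity τ) τ := by
  obtain ⟨C, hC, -, hφC, -⟩ := hφ.exists_isTest
  have hasDerivAt_coe : HasDerivAt (fun σ => (hφ.curve σ : L2 Ω (Fin d))) (hφ.velocity τ) τ :=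
    hasDerivAt_Lp_of_ae_eq hC (fun τ x => (hφC τ).eq_zero_of_notMem) hφ.hasDerivAt_apply
      hφ.continuous_timeDeriv hφ.curve_ae_eq hφ.velocity_ae_eq τ
  rw [hasDerivAt_iff_tendsto_slope] at hasDerivAt_coe ⊢
  exact tendsto_subtype_rng.2 hasDerivAt_coe

theorem continuous_curve (hφ : IsC1Sol Ω φ) : Continuous hφ.curve :=
  continuous_iff_continuousAt.2 fun τ => (hφ.hasDerivAt_curve τ).continuousAt

theorem continuous_Lp_of_ae_eq_curve (hφ : IsC1Sol Ω φ) {p : ℝ≥0∞} [Fact (1 ≤ p)]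
    {V : ℝ → Lp (Eu d) p (volume.restrict Ω)}
    (hV : ∀ τ, V τ =ᵐ[volume.restrict Ω] (hφ.curve τ : L2 Ω (Fin d))) : Continuous V := by
  obtain ⟨C, hC, -, hφC, -⟩ := hφ.exists_isTest
  exact continuous_Lp_of_ae_eq hC (fun τ x => (hφC τ).eq_zero_of_notMem) hφ.continuous_uncurry
    fun τ => (hV τ).trans (hφ.curve_ae_eq τ)

theorem continuous_Lp_of_ae_eq_weakGrad (hΩ : IsOpen Ω) (hφ : IsC1Sol Ω φ) {p : ℝ≥0∞}
    [Fact (1 ≤ p)] {D : ℝ → Lp (EuclideanSpace ℝ (Fin d × Fin d)) p (volume.restrict Ω)}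
    (hD : ∀ τ, D τ =ᵐ[volume.restrict Ω] weakGrad Ω (hφ.curve τ : L2 Ω (Fin d))) :
    Continuous D := by
  obtain ⟨C, hC, -, hφC, -⟩ := hφ.exists_isTest
  exact continuous_Lp_of_ae_eq hC (fun τ x => (hφC τ).jacobian.eq_zero_of_notMem)
    hφ.continuous_jacobian fun τ => (hD τ).trans (hφ.weakGrad_curve_ae_eq hΩ τ)

theorem continuous_weakGrad (hΩ : IsOpen Ω) (hφ : IsC1Sol Ω φ) :
    Continuous fun τ => weakGrad Ω (hφ.curve τ : L2 Ω (Fin d)) :=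
  hφ.continuous_Lp_of_ae_eq_weakGrad hΩ fun _ => .rfl

theorem continuous_weakGrad_weakGrad (hΩ : IsOpen Ω) (hφ : IsC1Sol Ω φ) :
    Continuous fun τ => weakGrad Ω (weakGrad Ω (hφ.curve τ : L2 Ω (Fin d))) := by
  obtain ⟨C, hC, -, hφC, -⟩ := hφ.exists_isTest
  exact continuous_Lp_of_ae_eq hC (fun τ x => (hφC τ).jacobian.jacobian.eq_zero_of_notMem)
    hφ.continuous_jacobian_jacobian fun τ =>
      (hφ.isSolTest τ).1.jacobian.weakGrad_ae_eq hΩ (hφ.weakGrad_curve_ae_eq hΩ τ)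

theorem memX_curve (hΩ : IsOpen Ω) (hφ : IsC1Sol Ω φ) (T ν : ℝ) : MemX Ω T ν hφ.curve where
  bounded := memLp_timeMeasure_of_continuous hφ.continuous_curve T ⊤
  mem_H10sol _ := .of_forall fun τ => (hφ.isSolTest τ).mem_H10sol hΩ
  grad_memLp _ := memLp_timeMeasure_of_continuous (hφ.continuous_weakGrad hΩ) T 2

theorem memY_curve (hΩ : IsOpen Ω) (hφ : IsC1Sol Ω φ) (T ν : ℝ) :
    MemY Ω T ν hφ.curve hφ.velocity where
  memX := hφ.memX_curve hΩ T ν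
  hasWeakGrad := .of_forall fun τ => (hφ.isSolTest τ).1.isWeakGrad_weakGrad (hφ.curve_ae_eq τ)
  hasWeakGrad_two _ := .of_forall fun τ =>
    (hφ.isSolTest τ).1.jacobian.isWeakGrad_weakGrad (hφ.weakGrad_curve_ae_eq hΩ τ)
  memLp_two _ := memLp_timeMeasure_of_continuous (hφ.continuous_weakGrad_weakGrad hΩ) T 2
  lipschitz := by
    have hV := fun τ => (hφ.memLp_top_curve τ).coeFn_toLp
    have hD := fun τ => (hφ.memLp_top_weakGrad_curve hΩ τ).coeFn_toLp
    exact ⟨_, _, memLp_timeMeasure_of_continuous (hφ.continuous_Lp_of_ae_eq_curve hV) T 1,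
      memLp_timeMeasure_of_continuous (hφ.continuous_Lp_of_ae_eq_weakGrad hΩ hD) T 1,
      .of_forall fun τ => ⟨hV τ, hD τ⟩⟩
  timeDeriv_memLp := memLp_timeMeasure_of_continuous hφ.continuous_velocity T 2
  hasTimeDeriv t _ := by
    rw [intervalIntegral.integral_eq_sub_of_hasDerivAt (fun τ _ => hφ.hasDerivAt_curve τ)
      (hφ.continuous_velocity.intervalIntegrable 0 t), add_sub_cancel]

end IsC1Sol

theorem IsSolTest.isC1Sol_const {ψ : Eu d → Eu d} (hψ : IsSolTest Ω ψ) :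
    IsC1Sol Ω (fun _ => ψ) := by
  have timeDeriv_eq_zero : timeDeriv (fun _ : ℝ => ψ) = 0 := by
    ext1 τ
    ext1 x
    exact deriv_const τ (ψ x)
  refine ⟨⟨tsupport ψ, hψ.1.2.1, hψ.1.2.2, fun _ _ => image_eq_zero_of_notMem_tsupport⟩,
    fun _ => hψ.1.1, fun _ => hψ.2, ?_, ?_, ?_⟩
  · exact fun _ => timeDeriv_eq_zero ▸ contDiff_const
  · intro n τ x
    simp only [timeDeriv_eq_zero, Pi.zero_apply, iteratedFDeriv_zero]
    exact hasDerivAt_const τ _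
  · intro n
    simp only [timeDeriv_eq_zero, Pi.zero_apply, iteratedFDeriv_zero]
    exact continuous_const

end Curves

section RegularityMeasure

variable {d : ℕ} {Ω : Set (Eu d)}

theorem exists_contDiff_eLpNorm_sub_abs_mul_le {T A : ℝ} (hA : 0 < A) {g : ℝ → ℝ}
    (hg : Integrable g (timeMeasure T)) (hg_nonneg : ∀ τ, 0 ≤ g τ) {ε : ℝ} (hε : 0 < ε) :
    ∃ θ : ℝ → ℝ, ContDiff ℝ ∞ θ ∧
      eLpNorm (g - fun τ => |θ τ| * A) 1 (timeMeasure T) ≤ ENNReal.ofReal ε := by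
  obtain ⟨θ, -, hθ, g_near_θ⟩ :=
    (memLp_one_iff_integrable.2 hg).exist_eLpNorm_sub_le ENNReal.one_ne_top le_rfl hε
  refine ⟨fun τ => θ τ / A, hθ.div_const A, (eLpNorm_mono fun τ => ?_).trans g_near_θ⟩
  simp only [Pi.sub_apply, Real.norm_eq_abs, abs_div, abs_of_pos hA, div_mul_cancel₀ _ hA.ne']
  simpa only [abs_of_nonneg (hg_nonneg τ)] using abs_abs_sub_abs_le (g τ) (θ τ)

/-- An admissible regularity measure: a multiple of the `W^{1,∞}`-norm. The factor beats the norm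
of the convective form; the summand `1` keeps it positive. -/
def regMeasure (Ω : Set (Eu d)) (u : L2sol Ω) : ℝ≥0∞ :=
  ENNReal.ofReal (2 * ‖contract d‖ + 1) *
    (eLpNorm (u : L2 Ω (Fin d)) ⊤ (volume.restrict Ω)
      + eLpNorm (weakGrad Ω (u : L2 Ω (Fin d))) ⊤ (volume.restrict Ω))

theorem ofReal_two_mul_norm_contract_add_one_ne_zero (d : ℕ) :
    ENNReal.ofReal (2 * ‖contract d‖ + 1) ≠ 0 :=
  (ENNReal.ofReal_pos.2 (by positivity)).ne'

theorem regMeasure_ne_top_iff {u : L2sol Ω} : regMeasure Ω u ≠ ⊤ ↔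
    MemLp (u : L2 Ω (Fin d)) ⊤ (volume.restrict Ω) ∧
      MemLp (weakGrad Ω (u : L2 Ω (Fin d))) ⊤ (volume.restrict Ω) := by
  simp [regMeasure, ENNReal.mul_eq_top, MemLp, Lp.aestronglyMeasurable, lt_top_iff_ne_top,
    -ENNReal.ofReal_eq_zero, ofReal_two_mul_norm_contract_add_one_ne_zero]

theorem regMeasure_smul (hΩ : IsOpen Ω) (c : ℝ) (u : L2sol Ω) :
    regMeasure Ω (c • u) = ‖c‖ₑ * regMeasure Ω u := by
  rw [regMeasure, regMeasure, Submodule.coe_smul, weakGrad_const_smul hΩ,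
    eLpNorm_congr_ae (Lp.coeFn_smul c (u : L2 Ω (Fin d))), eLpNorm_const_smul,
    eLpNorm_congr_ae (Lp.coeFn_smul c (weakGrad Ω (u : L2 Ω (Fin d)))), eLpNorm_const_smul,
    ← mul_add, mul_left_comm]

theorem regMeasure_zero (hΩ : IsOpen Ω) : regMeasure Ω 0 = 0 := by
  simpa using regMeasure_smul hΩ 0 (0 : L2sol Ω)

theorem regMeasure_ne_zero {u : L2sol Ω} (hu : u ≠ 0) : regMeasure Ω u ≠ 0 := by
  rw [regMeasure, mul_ne_zero_iff]
  refine ⟨ofReal_two_mul_norm_contract_add_one_ne_zero d, fun h => hu (Subtype.ext ?_)⟩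
  exact Lp.eq_zero_iff_ae_eq_zero.2
    ((eLpNorm_eq_zero_iff (Lp.memLp _).1 ENNReal.top_ne_zero).1 (add_eq_zero.1 h).1)

theorem abs_convForm_weakGrad_le_regMeasure_mul {u : L2sol Ω} (hu : regMeasure Ω u ≠ ⊤)
    (a : L2 Ω (Fin d)) :
    |convForm a (weakGrad Ω (u : L2 Ω (Fin d))) a|
      ≤ (regMeasure Ω u).toReal * (1 / 2 * ‖a‖ ^ 2) := by
  have hDu := (regMeasure_ne_top_iff.1 hu).2
  have factor_le : 2 * ‖contract d‖ *
      (eLpNorm (weakGrad Ω (u : L2 Ω (Fin d))) ⊤ (volume.restrict Ω)).toReal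
        ≤ (regMeasure Ω u).toReal := by
    rw [← ENNReal.toReal_ofReal (by positivity : 0 ≤ 2 * ‖contract d‖), ← ENNReal.toReal_mul]
    refine ENNReal.toReal_mono hu (mul_le_mul' (ENNReal.ofReal_le_ofReal ?_) le_add_self)
    linarith
  calc |convForm a (weakGrad Ω (u : L2 Ω (Fin d))) a|
      ≤ ‖contract d‖ * (eLpNorm (weakGrad Ω (u : L2 Ω (Fin d))) ⊤ (volume.restrict Ω)).toReal
          * ‖a‖ * ‖a‖ := abs_convForm_le_of_bdd_mid hDu a a
    _ = 2 * ‖contract d‖ * (eLpNorm (weakGrad Ω (u : L2 Ω (Fin d))) ⊤ (volume.restrict Ω)).toReal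
          * (1 / 2 * ‖a‖ ^ 2) := by ring
    _ ≤ (regMeasure Ω u).toReal * (1 / 2 * ‖a‖ ^ 2) := by gcongr

theorem relForm_regMeasure_nonneg (hΩ : IsOpen Ω) {ν : ℝ} (hν : 0 ≤ ν) {v u : L2sol Ω}
    (hv : 0 < ν → ((v : L2 Ω (Fin d)), weakGrad Ω (v : L2 Ω (Fin d))) ∈ H10sol Ω)
    (hu : 0 < ν → ((u : L2 Ω (Fin d)), weakGrad Ω (u : L2 Ω (Fin d))) ∈ H10sol Ω)
    (hK : regMeasure Ω u ≠ ⊤) : 0 ≤ relForm ν (regMeasure Ω) v u := by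
  obtain ⟨u_bdd, Du_bdd⟩ := regMeasure_ne_top_iff.1 hK
  have convForm_ge : -((regMeasure Ω u).toReal * relEnergy v u) ≤
      convForm ((v - u : L2sol Ω) : L2 Ω (Fin d)) (weakGrad Ω (u : L2 Ω (Fin d)))
        ((v - u : L2sol Ω) : L2 Ω (Fin d)) :=
    neg_le_of_abs_le (abs_convForm_weakGrad_le_regMeasure_mul hK _)
  rw [relForm]
  split_ifs with hν0
  · rw [symForm_eq_convForm]
    linarith
  · have hν_pos : 0 < ν := lt_of_le_of_ne hν (Ne.symm hν0)
    have diff_mem := H10sol_le_H10 (Submodule.sub_mem _ (hv hν_pos) (hu hν_pos))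
    have hDu := isWeakGrad_of_mem_H10 (H10sol_le_H10 (hu hν_pos))
    have by_parts := convForm_eq_neg_of_bdd hΩ (v - u).2 diff_mem hDu u_bdd Du_bdd
    have dissipation_nonneg := mul_nonneg hν
      (sq_nonneg ‖weakGrad Ω (v : L2 Ω (Fin d)) - weakGrad Ω (u : L2 Ω (Fin d))‖)
    change convForm _ _ _ = -convForm _ _ ((v - u : L2sol Ω) : L2 Ω (Fin d)) at by_parts
    rw [by_parts]
    linarith

theorem MemX.congr_ae {T ν : ℝ} {u u' : ℝ → L2sol Ω} (hu : MemX Ω T ν u)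
    (h : u =ᵐ[timeMeasure T] u') : MemX Ω T ν u' where
  bounded := (memLp_congr_ae h).1 hu.bounded
  mem_H10sol hν := by
    filter_upwards [hu.mem_H10sol hν, h] with τ hτ eq
    rwa [← eq]
  grad_memLp hν := (memLp_congr_ae (h.fun_comp fun z : L2sol Ω => weakGrad Ω z.1)).1
    (hu.grad_memLp hν)

theorem mem_KDomain_congr_ae {T ν : ℝ} {K : L2sol Ω → ℝ≥0∞} {u u' : ℝ → L2sol Ω}
    (hu : u ∈ KDomain Ω T ν K) (h : u =ᵐ[timeMeasure T] u') : u' ∈ KDomain Ω T ν K :=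
  ⟨hu.1.congr_ae h, hu.2.1.congr (h.fun_comp K),
    (lintegral_congr_ae (h.fun_comp K)).symm.trans_ne hu.2.2⟩

theorem IsC1Sol.continuous_toReal_regMeasure_curve (hΩ : IsOpen Ω) {φ : ℝ → Eu d → Eu d}
    (hφ : IsC1Sol Ω φ) : Continuous fun τ => (regMeasure Ω (hφ.curve τ)).toReal := by
  have continuous_curve := hφ.continuous_Lp_of_ae_eq_curve
    fun τ => (hφ.memLp_top_curve τ).coeFn_toLp
  have continuous_weakGrad := hφ.continuous_Lp_of_ae_eq_weakGrad hΩ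
    fun τ => (hφ.memLp_top_weakGrad_curve hΩ τ).coeFn_toLp
  refine ((continuous_curve.norm.add continuous_weakGrad.norm).const_mul
    (ENNReal.ofReal (2 * ‖contract d‖ + 1)).toReal).congr fun τ => ?_
  rw [Pi.add_apply, Lp.norm_toLp, Lp.norm_toLp, ← ENNReal.toReal_add (hφ.memLp_top_curve τ).2.ne
    (hφ.memLp_top_weakGrad_curve hΩ τ).2.ne, regMeasure, ENNReal.toReal_mul]

theorem IsC1Sol.curve_mem_KDomain (hΩ : IsOpen Ω) (T ν : ℝ) {φ : ℝ → Eu d → Eu d}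
    (hφ : IsC1Sol Ω φ) : hφ.curve ∈ KDomain Ω T ν (regMeasure Ω) := by
  have continuous_toReal := hφ.continuous_toReal_regMeasure_curve hΩ
  have ne_top τ : regMeasure Ω (hφ.curve τ) ≠ ⊤ :=
    regMeasure_ne_top_iff.2 ⟨hφ.memLp_top_curve τ, hφ.memLp_top_weakGrad_curve hΩ τ⟩
  have regMeasure_eq : (fun τ => regMeasure Ω (hφ.curve τ)) =
      fun τ => ENNReal.ofReal (regMeasure Ω (hφ.curve τ)).toReal :=
    funext fun τ => (ENNReal.ofReal_toReal (ne_top τ)).symm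
  refine ⟨hφ.memX_curve hΩ T ν, ?_, ?_⟩ <;> rw [regMeasure_eq]
  · exact continuous_toReal.measurable.ennreal_ofReal.aemeasurable
  · exact (memLp_one_iff_integrable.1
      (memLp_timeMeasure_of_continuous continuous_toReal T 1)).lintegral_lt_top.ne

theorem IsC1SolOn.mem_KDomain (hΩ : IsOpen Ω) {T : ℝ} (ν : ℝ) {u : ℝ → L2sol Ω}
    (hu : IsC1SolOn Ω T u) : u ∈ KDomain Ω T ν (regMeasure Ω) := by
  obtain ⟨φ, hφ, hu⟩ := hu
  refine mem_KDomain_congr_ae (hφ.curve_mem_KDomain hΩ T ν) ?_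
  filter_upwards [ae_restrict_mem measurableSet_Ioo] with τ hτ
  exact Subtype.ext (Lp.ext ((hφ.curve_ae_eq τ).trans (hu τ (Ioo_subset_Icc_self hτ)).symm))

theorem exists_isSolTest_toL2_ne_zero {u : L2sol Ω} (hu : u ≠ 0) :
    ∃ ψ, IsSolTest Ω ψ ∧ toL2 Ω ψ ≠ 0 := by
  by_contra! toL2_eq_zero
  have L2sol_le_bot : L2sol Ω ≤ ⊥ := by
    refine Submodule.topologicalClosure_minimal _ (Submodule.span_le.2 ?_) isClosed_singleton
    rintro u ⟨ψ, hψ, hu⟩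
    exact (Lp.ext (hu.trans (toL2_ae_eq hψ.1).symm)).trans (toL2_eq_zero ψ hψ)
  exact hu (Subtype.ext ((Submodule.mem_bot ℝ).1 (L2sol_le_bot u.2)))

theorem isSolTest_zero : IsSolTest Ω (0 : Eu d → Eu d) := by
  refine ⟨⟨contDiff_const, HasCompactSupport.zero, ?_⟩, fun x => ?_⟩
  · rw [tsupport_eq_empty_iff.2 rfl]
    exact empty_subset _
  · simp [diverg, grad]

-- `KMap` sees only the `W^{1,∞}` norm of `u τ`, so multiples `θ τ • ψ` of one fixed field suffice.
theorem exists_isC1SolOn_edist_KMap_le (hΩ : IsOpen Ω) {T ν : ℝ}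
    (u : KDomain Ω T ν (regMeasure Ω)) {ε : ℝ} (hε : 0 < ε) :
    ∃ u' : KDomain Ω T ν (regMeasure Ω), IsC1SolOn Ω T (u' : ℝ → L2sol Ω) ∧
      edist (KMap Ω T ν (regMeasure Ω) u) (KMap Ω T ν (regMeasure Ω) u') ≤ ENNReal.ofReal ε := by
  by_cases hu : (u : ℝ → L2sol Ω) = 0
  · refine ⟨u, ⟨fun _ => 0, isSolTest_zero.isC1Sol_const, fun τ _ => ?_⟩, by simp⟩
    rw [hu]
    exact Lp.coeFn_zero _ _ _
  obtain ⟨τ, hτ⟩ := Function.ne_iff.1 hu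
  obtain ⟨ψ, hψ, hψ_ne⟩ := exists_isSolTest_toL2_ne_zero hτ
  set U : L2sol Ω := ⟨toL2 Ω ψ, hψ.toL2_mem_L2sol⟩
  have U_ne_zero : U ≠ 0 := fun h => hψ_ne (congrArg Subtype.val h)
  have U_ne_top : regMeasure Ω U ≠ ⊤ := regMeasure_ne_top_iff.2
    ⟨hψ.isC1Sol_const.memLp_top_curve 0, hψ.isC1Sol_const.memLp_top_weakGrad_curve hΩ 0⟩
  obtain ⟨θ, hθ, θ_near⟩ := exists_contDiff_eLpNorm_sub_abs_mul_le
    (ENNReal.toReal_pos (regMeasure_ne_zero U_ne_zero) U_ne_top)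
    (integrable_toReal_of_lintegral_ne_top u.2.2.1 u.2.2.2) (fun _ => ENNReal.toReal_nonneg) hε
  have hφ : IsC1Sol Ω fun τ x => θ τ • ψ x := hψ.isC1Sol_const.time_smul
    (fun τ => (hθ.differentiable (by simp) τ).hasDerivAt) (hθ.continuous_deriv (by simp))
  refine ⟨⟨hφ.curve, hφ.curve_mem_KDomain hΩ T ν⟩, ⟨_, hφ, fun τ _ => hφ.curve_ae_eq τ⟩, ?_⟩
  have toReal_curve τ : (regMeasure Ω (hφ.curve τ)).toReal
      = |θ τ| * (regMeasure Ω U).toReal := by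
    rw [show hφ.curve τ = θ τ • U from hψ.isC1Sol_const.curve_time_smul hφ τ, regMeasure_smul hΩ,
      ENNReal.toReal_mul, toReal_enorm, Real.norm_eq_abs]
  simpa only [KMap, Integrable.toL1, Lp.edist_toLp_toLp, toReal_curve] using θ_near

theorem isAdmissible_regMeasure (hΩ : IsOpen Ω) (T : ℝ) {ν : ℝ} (hν : 0 ≤ ν) :
    IsAdmissible Ω T ν (regMeasure Ω) where
  map_zero := regMeasure_zero hΩ
  subset_domain _ hu := hu.mem_KDomain hΩ ν
  exists_topology := by
    refine ⟨.induced (KMap Ω T ν (regMeasure Ω)) inferInstance, continuous_induced_dom,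
      fun u => ?_⟩
    rw [closure_induced, mem_closure_iff_nhds_basis Metric.nhds_basis_closedBall]
    intro ε hε
    obtain ⟨u', hu', edist_le⟩ := exists_isC1SolOn_edist_KMap_le hΩ u hε
    exact ⟨_, mem_image_of_mem _ hu',
      Metric.mem_closedBall'.2 ((edist_le_ofReal hε.le).1 edist_le)⟩
  relForm_nonneg v hv u w hu hK := by
    filter_upwards [eventually_imp_distrib_left.2 hv.mem_H10sol,
      eventually_imp_distrib_left.2 hu.memX.mem_H10sol, ae_lt_top' hK.2.1 hK.2.2]
      with τ hvτ huτ hKτ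
    exact relForm_regMeasure_nonneg hΩ hν hvτ huτ hKτ.ne

end RegularityMeasure

section EssentialLimits

theorem nhdsWithin_inf_ae_neBot {X : Type*} [TopologicalSpace X] [MeasurableSpace X]
    {μ : Measure X} [μ.IsOpenPosMeasure] {s : Set X} (hs : IsOpen s) {x : X}
    (hx : x ∈ closure s) : (𝓝[s] x ⊓ ae μ).NeBot := by
  refine inf_neBot_iff.2 fun {u} hu {w} hw => ?_
  obtain ⟨o, ho, hxo, hou⟩ := mem_nhdsWithin.1 hu
  obtain ⟨y, hy, hyw⟩ : ((o ∩ s) ∩ w).Nonempty := nonempty_of_measure_ne_zero <| by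
    rw [measure_inter_conull hw]
    exact ((ho.inter hs).measure_pos μ (mem_closure_iff.1 hx o ho hxo)).ne'
  exact ⟨y, hou hy, hyw⟩

theorem rightLim_neBot (T t : ℝ) : (rightLim T t).NeBot := by
  rw [rightLim]
  split_ifs
  · exact nhdsWithin_inf_ae_neBot isOpen_Ioi (by simp)
  · exact nhdsWithin_inf_ae_neBot isOpen_Iio (by simp)

theorem leftLim_neBot (s : ℝ) : (leftLim s).NeBot := by
  rw [leftLim]
  split_ifs
  · exact nhdsWithin_inf_ae_neBot isOpen_Iio (by simp)
  · exact nhdsWithin_inf_ae_neBot isOpen_Ioi (by simp)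

theorem nhdsLE_inf_ae_eq {μ : Measure ℝ} [NullSingletonClass μ] (q : ℝ) :
    𝓝[≤] q ⊓ ae μ = 𝓝[<] q ⊓ ae μ := by
  refine le_antisymm ?_ (inf_le_inf_right _ (nhdsWithin_mono q Iio_subset_Iic_self))
  rw [nhdsWithin, nhdsWithin, inf_assoc, inf_assoc]
  refine le_inf inf_le_left (le_inf ?_ (inf_le_right.trans inf_le_right))
  refine le_principal_iff.2 <| (inf_le_right : 𝓝 q ⊓ (𝓟 (Iic q) ⊓ ae μ) ≤ _) ?_
  exact mem_of_superset (inter_mem_inf (mem_principal_self _) (compl_mem_ae_iff.2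
    (measure_singleton q))) fun x hx => lt_of_le_of_ne hx.1 hx.2

variable {E : Type*} [NormedAddCommGroup E] [NormedSpace ℝ E] [CompleteSpace E] {g : ℝ → E}

theorem ae_eq_of_tendsto_nhdsLT_inf_ae (hg : LocallyIntegrable g) :
    ∀ᵐ q, ∀ b, Tendsto g (𝓝[<] q ⊓ ae volume) (𝓝 b) → b = g q := by
  filter_upwards [LocallyIntegrable.ae_hasDerivAt_integral hg] with q hq b hb
  rw [← nhdsLE_inf_ae_eq] at hb
  exact (uniqueDiffWithinAt_Iic q).eq_deriv _
    (intervalIntegral.integral_hasDerivWithinAt_of_tendsto_ae_right (s := Iic q) (t := Iic q)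
      .refl hg.aestronglyMeasurable.stronglyMeasurableAtFilter hb)
    (hq q).hasDerivWithinAt

theorem ae_eq_of_tendsto_nhdsGT_inf_ae (hg : LocallyIntegrable g) :
    ∀ᵐ q, ∀ b, Tendsto g (𝓝[>] q ⊓ ae volume) (𝓝 b) → b = g q := by
  filter_upwards [LocallyIntegrable.ae_hasDerivAt_integral hg] with q hq b hb
  exact (uniqueDiffWithinAt_Ici q).eq_deriv _
    (intervalIntegral.integral_hasDerivWithinAt_of_tendsto_ae_right (s := Ici q) (t := Ioi q)
      .refl hg.aestronglyMeasurable.stronglyMeasurableAtFilter hb)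
    (hq q).hasDerivWithinAt

end EssentialLimits

section Force

variable {d : ℕ} {Ω : Set (Eu d)}

theorem hm1Pair_eq {F : Hm1 Ω} {u : L2 Ω (Fin d)} {G : L2 Ω (Fin d × Fin d)}
    (hG : weakGrad Ω u = G) (h : (u, G) ∈ H10 Ω) : hm1Pair F u = F ⟨(u, G), h⟩ := by
  subst hG
  exact dif_pos h

theorem hm1Pair_zero_left (u : L2 Ω (Fin d)) : hm1Pair (0 : Hm1 Ω) u = 0 := by
  rw [hm1Pair]
  split_ifs <;> rfl

theorem hm1Pair_sub (hΩ : IsOpen Ω) (F : Hm1 Ω) {u u' : L2 Ω (Fin d)}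
    (h : (u, weakGrad Ω u) ∈ H10 Ω) (h' : (u', weakGrad Ω u') ∈ H10 Ω) :
    hm1Pair F (u - u') = hm1Pair F u - hm1Pair F u' := by
  have weakGrad_sub : weakGrad Ω (u - u') = weakGrad Ω u - weakGrad Ω u' :=
    ((isWeakGrad_of_mem_H10 h).sub (isWeakGrad_of_mem_H10 h')).weakGrad_eq hΩ
  rw [hm1Pair_eq rfl h, hm1Pair_eq rfl h', hm1Pair_eq weakGrad_sub ((H10 Ω).sub_mem h h'),
    ← map_sub]
  rfl

theorem hm1Pair_smul (hΩ : IsOpen Ω) (F : Hm1 Ω) {u : L2 Ω (Fin d)}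
    (h : (u, weakGrad Ω u) ∈ H10 Ω) (c : ℝ) : hm1Pair F (c • u) = c * hm1Pair F u := by
  rw [hm1Pair_eq rfl h, hm1Pair_eq (weakGrad_const_smul hΩ c u) ((H10 Ω).smul_mem c h),
    ← smul_eq_mul, ← map_smul]
  rfl

theorem forcePair_smul (hΩ : IsOpen Ω) (F : Hm1 Ω × L2 Ω (Fin d)) {u : L2 Ω (Fin d)}
    (h : (u, weakGrad Ω u) ∈ H10 Ω) (c : ℝ) : forcePair F (c • u) = c * forcePair F u := by
  rw [forcePair, forcePair, hm1Pair_smul hΩ F.1 h, real_inner_smul_right, mul_add]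

theorem forcePair_sub (hΩ : IsOpen Ω) {ν : ℝ} (hν : 0 ≤ ν) {F : Hm1 Ω × L2 Ω (Fin d)}
    (hF : ν = 0 → F.1 = 0) {u u' : L2 Ω (Fin d)}
    (h : 0 < ν → (u, weakGrad Ω u) ∈ H10 Ω) (h' : 0 < ν → (u', weakGrad Ω u') ∈ H10 Ω) :
    forcePair F (u - u') = forcePair F u - forcePair F u' := by
  have hm1Pair_fst_sub : hm1Pair F.1 (u - u') = hm1Pair F.1 u - hm1Pair F.1 u' := by
    rcases hν.eq_or_lt with ν_eq | ν_pos
    · simp only [hF ν_eq.symm, hm1Pair_zero_left, sub_zero]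
    · exact hm1Pair_sub hΩ F.1 (h ν_pos) (h' ν_pos)
  rw [forcePair, forcePair, forcePair, hm1Pair_fst_sub, inner_sub_right]
  ring

theorem integrable_inner_of_memLp {α E : Type*} [MeasurableSpace α] {μ : Measure α}
    [NormedAddCommGroup E] [InnerProductSpace ℝ E] {p q : ℝ≥0∞} [p.HolderTriple q 1]
    {g h : α → E} (hg : MemLp g p μ) (hh : MemLp h q μ) :
    Integrable (fun x => inner ℝ (g x) (h x)) μ := by
  refine memLp_one_iff_integrable.1 (MemLp.of_bilin (r := 1) (fun x y => inner ℝ x y) 1 hg hh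
    (hg.1.inner hh.1) (.of_forall fun x => ?_))
  simpa only [one_mul] using nnnorm_inner_le_nnnorm (𝕜 := ℝ) (g x) (h x)

theorem integrable_clm_apply_of_memLp {α P : Type*} [MeasurableSpace α] {μ : Measure α}
    [NormedAddCommGroup P] [NormedSpace ℝ P] {p q : ℝ≥0∞} [p.HolderTriple q 1]
    {F : α → StrongDual ℝ P} {x : α → P} (hF : MemLp F p μ) (hx : MemLp x q μ) :
    Integrable (fun τ => F τ (x τ)) μ := by
  refine memLp_one_iff_integrable.1 (MemLp.of_bilin (r := 1)
    (fun (ℓ : StrongDual ℝ P) (y : P) => ℓ y) 1 hF hx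
    (isBoundedBilinearMap_apply.continuous.comp_aestronglyMeasurable (hF.1.prodMk hx.1))
    (.of_forall fun τ => ?_))
  simpa only [one_mul] using (F τ).le_opNNNorm (x τ)

theorem exists_memLp_subtype_of_ae_mem {α P : Type*} [MeasurableSpace α] {μ : Measure α}
    [NormedAddCommGroup P] [NormedSpace ℝ P] {S : Submodule ℝ P} {p : ℝ≥0∞} {x : α → P}
    (hx : MemLp x p μ) (hxS : ∀ᵐ τ ∂μ, x τ ∈ S) :
    ∃ y : α → S, MemLp y p μ ∧ x =ᵐ[μ] fun τ => (y τ : P) := by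
  classical
  let y : α → S := fun τ => if h : x τ ∈ S then ⟨x τ, h⟩ else 0
  have x_ae_eq : x =ᵐ[μ] fun τ => (y τ : P) := hxS.mono fun τ hτ => by simp only [y, dif_pos hτ]
  have memLp_coe := (memLp_congr_ae x_ae_eq).1 hx
  exact ⟨y, ⟨Topology.IsEmbedding.subtypeVal.aestronglyMeasurable_comp_iff.1 memLp_coe.1,
    (eLpNorm_congr_norm_ae (.of_forall fun _ => rfl)).trans_lt memLp_coe.2⟩, x_ae_eq⟩

theorem MemX.memLp_coe {T ν : ℝ} {v : ℝ → L2sol Ω} (hv : MemX Ω T ν v) :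
    MemLp (fun τ => (v τ : L2 Ω (Fin d))) ⊤ (timeMeasure T) :=
  (L2sol Ω).subtypeL.comp_memLp' hv.bounded

theorem MemX.integrable_hm1Pair {T ν : ℝ} (hν : 0 < ν) {v : ℝ → L2sol Ω}
    (hv : MemX Ω T ν v) {F : ℝ → Hm1 Ω} (hF : MemLp F 2 (timeMeasure T)) :
    Integrable (fun τ => hm1Pair (F τ) (v τ)) (timeMeasure T) := by
  have memLp_pair : MemLp (fun τ => ((v τ : L2 Ω (Fin d)), weakGrad Ω (v τ : L2 Ω (Fin d)))) 2
      (timeMeasure T) := memLp_prod_iff.2 ⟨hv.memLp_coe.mono_exponent le_top, hv.grad_memLp hν⟩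
  obtain ⟨y, hy, pair_eq⟩ := exists_memLp_subtype_of_ae_mem memLp_pair
    ((hv.mem_H10sol hν).mono fun τ hτ => H10sol_le_H10 hτ)
  refine (integrable_clm_apply_of_memLp hF hy).congr ?_
  filter_upwards [pair_eq] with τ hτ
  have v_eq : (v τ : L2 Ω (Fin d)) = (y τ).1.1 := congrArg Prod.fst hτ
  rw [hm1Pair_eq (congrArg Prod.snd hτ) (v_eq ▸ (y τ).2)]
  exact congrArg (F τ) (Subtype.ext (Prod.ext v_eq.symm rfl))

theorem MemX.integrable_forcePair {T ν : ℝ} (hν : 0 ≤ ν) {v : ℝ → L2sol Ω}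
    (hv : MemX Ω T ν v) {f : ℝ → Hm1 Ω × L2 Ω (Fin d)} (hf : MemZ Ω T ν f) :
    Integrable (fun τ => forcePair (f τ) (v τ)) (timeMeasure T) := by
  refine Integrable.add ?_ (integrable_inner_of_memLp hf.snd_memLp hv.memLp_coe)
  rcases hν.eq_or_lt with ν_eq | ν_pos
  · refine (integrable_zero ℝ ℝ (timeMeasure T)).congr ?_
    filter_upwards [hf.fst_eq_zero ν_eq.symm] with τ hτ
    rw [hτ, hm1Pair_zero_left]
    rfl
  · exact hv.integrable_hm1Pair ν_pos hf.fst_memLp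

end Force

section RelativeEnergy

variable {d : ℕ} {Ω : Set (Eu d)}

/-- The integrand `ν‖∇v‖² - ⟨F, v⟩` of the energy balance at a fixed time. -/
def energyRate (ν : ℝ) (F : Hm1 Ω × L2 Ω (Fin d)) (v : L2 Ω (Fin d)) : ℝ :=
  ν * ‖weakGrad Ω v‖ ^ 2 - forcePair F v

/-- The integrand of the weak formulation at a fixed time, where `u` is the value of the test
field and `w` the value of its time derivative. -/
def weakRate (ν : ℝ) (F : Hm1 Ω × L2 Ω (Fin d)) (v u w : L2 Ω (Fin d)) : ℝ :=
  ν * inner ℝ (weakGrad Ω v) (weakGrad Ω u) - convForm v (weakGrad Ω u) v - inner ℝ v w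
    - forcePair F u

theorem relForm_add_systemOp_sub (hΩ : IsOpen Ω) {ν : ℝ} (hν : 0 ≤ ν)
    {F : Hm1 Ω × L2 Ω (Fin d)} (hF : ν = 0 → F.1 = 0) {v : L2sol Ω}
    (hv : 0 < ν → ((v : L2 Ω (Fin d)), weakGrad Ω (v : L2 Ω (Fin d))) ∈ H10sol Ω)
    {φ : Eu d → Eu d} (hφ : IsSolTest Ω φ) {u : L2sol Ω} (hu : (u : L2 Ω (Fin d)) = toL2 Ω φ)
    (w : L2sol Ω) (K : L2sol Ω → ℝ≥0∞) :
    relForm ν K v u + systemOp ν F u w ((v - u : L2sol Ω) : L2 Ω (Fin d))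
        - (K u).toReal * relEnergy v u
      = energyRate ν F v - weakRate ν F v u w - inner ℝ w u := by
  have u_ae_eq : (u : L2 Ω (Fin d)) =ᵐ[volume.restrict Ω] φ := hu ▸ toL2_ae_eq hφ.1
  have hu_grad := hφ.1.isWeakGrad_weakGrad u_ae_eq
  have hu_top := hφ.1.memLp_top_of_ae_eq u_ae_eq
  have hDu_top := hφ.1.jacobian.memLp_top_of_ae_eq (hφ.1.weakGrad_ae_eq hΩ u_ae_eq)
  have convForm_v_u := convForm_eq_neg hΩ v.2 hu_grad hφ.1 u_ae_eq
  have convForm_u_u := convForm_eq_neg hΩ u.2 hu_grad hφ.1 u_ae_eq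
  have forcePair_v_sub_u := forcePair_sub hΩ hν hF (fun h => H10sol_le_H10 (hv h))
    (fun _ => H10sol_le_H10 (hu ▸ hφ.mem_H10sol hΩ))
  have inner_w_sub : inner ℝ (w : L2 Ω (Fin d)) ((v : L2 Ω (Fin d)) - u)
      = inner ℝ (v : L2 Ω (Fin d)) w - inner ℝ w u := by
    rw [inner_sub_right, real_inner_comm]
    rfl
  simp only [relForm, systemOp, energyRate, weakRate, Submodule.coe_sub, forcePair_v_sub_u,
    inner_w_sub]
  rcases hν.eq_or_lt with rfl | ν_pos
  · simp only [if_true, symForm_eq_convForm, convForm_sub_left_of_bdd_mid hDu_top,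
      convForm_sub_right hDu_top]
    linarith
  · have hv_grad : IsWeakGrad Ω (v : L2 Ω (Fin d)) (weakGrad Ω (v : L2 Ω (Fin d))) :=
      isWeakGrad_of_mem_H10 (H10sol_le_H10 (hv ν_pos))
    have convForm_v_v := convForm_eq_neg hΩ v.2 hv_grad hφ.1 u_ae_eq
    have convForm_u_v := convForm_eq_neg hΩ u.2 hv_grad hφ.1 u_ae_eq
    rw [laplaceForm_eq_neg_inner hΩ hφ.1 u_ae_eq (hv_grad.sub hu_grad)]
    simp only [ν_pos.ne', if_false, convForm_sub_left_of_bdd_right hu_top,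
      convForm_sub_mid hu_top, convForm_sub_right hDu_top, norm_sub_sq_real, inner_sub_left,
      real_inner_self_eq_norm_sq]
    linarith

theorem MemX.relForm_add_systemOp_sub_curve (hΩ : IsOpen Ω) {T ν : ℝ} (hν : 0 ≤ ν)
    {v : ℝ → L2sol Ω} (hv : MemX Ω T ν v) {f : ℝ → Hm1 Ω × L2 Ω (Fin d)} (hf : MemZ Ω T ν f)
    {φ : ℝ → Eu d → Eu d} (hφ : IsC1Sol Ω φ) (K : L2sol Ω → ℝ≥0∞) :
    ∀ᵐ τ ∂(timeMeasure T), relForm ν K (v τ) (hφ.curve τ)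
        + systemOp ν (f τ) (hφ.curve τ) (hφ.velocity τ)
            ((v τ - hφ.curve τ : L2sol Ω) : L2 Ω (Fin d))
        - (K (hφ.curve τ)).toReal * relEnergy (v τ) (hφ.curve τ)
      = energyRate ν (f τ) (v τ) - weakRate ν (f τ) (v τ) (hφ.curve τ) (hφ.velocity τ)
        - inner ℝ (hφ.velocity τ) (hφ.curve τ) := by
  filter_upwards [eventually_imp_distrib_left.2 hf.fst_eq_zero,
    eventually_imp_distrib_left.2 hv.mem_H10sol] with τ hf_fst hv_mem
  exact relForm_add_systemOp_sub hΩ hν hf_fst hv_mem (hφ.isSolTest τ) rfl _ _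

theorem MemX.integrable_energyRate {T ν : ℝ} (hν : 0 ≤ ν) {v : ℝ → L2sol Ω}
    (hv : MemX Ω T ν v) {f : ℝ → Hm1 Ω × L2 Ω (Fin d)} (hf : MemZ Ω T ν f) :
    Integrable (fun τ => energyRate ν (f τ) (v τ)) (timeMeasure T) := by
  refine Integrable.sub ?_ (hv.integrable_forcePair hν hf)
  rcases hν.eq_or_lt with rfl | ν_pos
  · simp
  · exact ((hv.grad_memLp ν_pos).integrable_norm_pow two_ne_zero).const_mul ν

theorem MemX.integrable_convForm_weakGrad_curve (hΩ : IsOpen Ω) {T ν : ℝ} {v : ℝ → L2sol Ω}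
    (hv : MemX Ω T ν v) {φ : ℝ → Eu d → Eu d} (hφ : IsC1Sol Ω φ) :
    Integrable (fun τ => convForm (v τ) (weakGrad Ω (hφ.curve τ : L2 Ω (Fin d))) (v τ))
      (timeMeasure T) := by
  let D τ := (hφ.memLp_top_weakGrad_curve hΩ τ).toLp
  have D_ae_eq τ := (hφ.memLp_top_weakGrad_curve hΩ τ).coeFn_toLp
  simp only [convForm_eq_inner_of_bdd_mid (D_ae_eq _)]
  have memLp_holder : MemLp (fun τ => (contract d).holder 2 (D τ) (v τ : L2 Ω (Fin d))) 1
      (timeMeasure T) :=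
    ((contract d).holderL (volume.restrict Ω) ⊤ 2 2).memLp_of_bilin 1
      (memLp_timeMeasure_of_continuous (hφ.continuous_Lp_of_ae_eq_weakGrad hΩ D_ae_eq) T 1)
      hv.memLp_coe
  exact integrable_inner_of_memLp hv.memLp_coe memLp_holder

theorem MemX.integrable_weakRate (hΩ : IsOpen Ω) {T ν : ℝ} (hν : 0 ≤ ν) {v : ℝ → L2sol Ω}
    (hv : MemX Ω T ν v) {f : ℝ → Hm1 Ω × L2 Ω (Fin d)} (hf : MemZ Ω T ν f)
    {φ : ℝ → Eu d → Eu d} (hφ : IsC1Sol Ω φ) :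
    Integrable (fun τ => weakRate ν (f τ) (v τ) (hφ.curve τ) (hφ.velocity τ))
      (timeMeasure T) := by
  have integrable_grad : Integrable (fun τ => ν * inner ℝ (weakGrad Ω (v τ : L2 Ω (Fin d)))
      (weakGrad Ω (hφ.curve τ : L2 Ω (Fin d)))) (timeMeasure T) := by
    rcases hν.eq_or_lt with rfl | ν_pos
    · simp
    · exact (integrable_inner_of_memLp (hv.grad_memLp ν_pos)
        (memLp_timeMeasure_of_continuous (hφ.continuous_weakGrad hΩ) T 2)).const_mul ν
  have memLp_velocity : MemLp (fun τ => (hφ.velocity τ : L2 Ω (Fin d))) 1 (timeMeasure T) :=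
    memLp_timeMeasure_of_continuous (continuous_subtype_val.comp hφ.continuous_velocity) T 1
  exact ((integrable_grad.sub (hv.integrable_convForm_weakGrad_curve hΩ hφ)).sub
    (integrable_inner_of_memLp hv.memLp_coe memLp_velocity)).sub
    ((hφ.memX_curve hΩ T ν).integrable_forcePair hν hf)

theorem IsC1Sol.weakRate_eq (hΩ : IsOpen Ω) {φ : ℝ → Eu d → Eu d} (hφ : IsC1Sol Ω φ) (ν : ℝ)
    (F : Hm1 Ω × L2 Ω (Fin d)) (v : L2 Ω (Fin d)) (τ : ℝ) :
    weakRate ν F v (hφ.curve τ) (hφ.velocity τ) =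
      ν * (∫ x in Ω, inner ℝ (weakGrad Ω v x) (grad (φ τ) x))
        - (∫ x in Ω, ∑ i, ∑ j, v x i * v x j * grad (φ τ) x (i, j))
        - (∫ x in Ω, inner ℝ (v x) (timeDeriv φ τ x))
        - forcePair F (toL2 Ω (φ τ)) := by
  have weakGrad_ae_eq := hφ.weakGrad_curve_ae_eq hΩ τ
  rw [← grad_eq_jacobian] at weakGrad_ae_eq
  have inner_grad : inner ℝ (weakGrad Ω v) (weakGrad Ω (hφ.curve τ : L2 Ω (Fin d)))
      = ∫ x in Ω, inner ℝ (weakGrad Ω v x) (grad (φ τ) x) :=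
    integral_congr_ae (weakGrad_ae_eq.mono fun x hx => by simp only [hx])
  have convForm_grad : convForm v (weakGrad Ω (hφ.curve τ : L2 Ω (Fin d))) v
      = ∫ x in Ω, ∑ i, ∑ j, v x i * v x j * grad (φ τ) x (i, j) :=
    integral_congr_ae (weakGrad_ae_eq.mono fun x hx => by
      simp only [hx, mul_comm, mul_left_comm])
  have inner_velocity : inner ℝ v (hφ.velocity τ : L2 Ω (Fin d))
      = ∫ x in Ω, inner ℝ (v x) (timeDeriv φ τ x) :=
    integral_congr_ae ((hφ.velocity_ae_eq τ).mono fun x hx => by simp only [hx])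
  rw [weakRate, inner_grad, convForm_grad, inner_velocity]
  rfl

theorem convForm_smul_mid (c : ℝ) (a : L2 Ω (Fin d)) (G : L2 Ω (Fin d × Fin d))
    (b : L2 Ω (Fin d)) : convForm a (c • G) b = c * convForm a G b := by
  simp only [convForm_eq_integral_inner, ← integral_const_mul]
  refine integral_congr_ae ((Lp.coeFn_smul c G).mono fun x hx => ?_)
  simp only [hx, Pi.smul_apply, map_smul, smul_apply, real_inner_smul_right]

theorem IsC1Sol.weakRate_const_smul (hΩ : IsOpen Ω) {φ : ℝ → Eu d → Eu d} (hφ : IsC1Sol Ω φ)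
    (ν : ℝ) (F : Hm1 Ω × L2 Ω (Fin d)) (v : L2 Ω (Fin d)) (c τ : ℝ) :
    weakRate ν F v ((hφ.const_smul c).curve τ) ((hφ.const_smul c).velocity τ) =
      c * weakRate ν F v (hφ.curve τ) (hφ.velocity τ) := by
  have mem_H10 : ((hφ.curve τ : L2 Ω (Fin d)), weakGrad Ω (hφ.curve τ : L2 Ω (Fin d))) ∈ H10 Ω :=
    H10sol_le_H10 ((hφ.isSolTest τ).mem_H10sol hΩ)
  rw [hφ.curve_time_smul, hφ.velocity_const_smul, weakRate, weakRate, Submodule.coe_smul,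
    Submodule.coe_smul, weakGrad_const_smul hΩ, convForm_smul_mid, forcePair_smul hΩ F mem_H10,
    real_inner_smul_right, real_inner_smul_right]
  ring

theorem IsC1Sol.integral_inner_velocity_curve {φ : ℝ → Eu d → Eu d} (hφ : IsC1Sol Ω φ)
    (q r : ℝ) : ∫ τ in q..r, inner ℝ (hφ.velocity τ) (hφ.curve τ)
      = 1 / 2 * ‖hφ.curve r‖ ^ 2 - 1 / 2 * ‖hφ.curve q‖ ^ 2 := by
  refine intervalIntegral.integral_eq_sub_of_hasDerivAt
    (f := fun τ => 1 / 2 * ‖hφ.curve τ‖ ^ 2) (fun τ _ => ?_) (Continuous.intervalIntegrable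
      (hφ.continuous_velocity.inner (𝕜 := ℝ) hφ.continuous_curve) q r)
  refine ((hφ.hasDerivAt_curve τ).norm_sq.const_mul (1 / 2)).congr_deriv ?_
  rw [real_inner_comm]
  ring

end RelativeEnergy

section Solutions

variable {d : ℕ} {Ω : Set (Eu d)} {T ν : ℝ} {f : ℝ → Hm1 Ω × L2 Ω (Fin d)} {v₀ : L2sol Ω}
  {v : ℝ → L2sol Ω} {ξ : ℝ → ℝ} {s t q r : ℝ} {φ : ℝ → Eu d → Eu d}

theorem restrict_Ioc_le_timeMeasure (hq : 0 ≤ q) (hr : r ≤ T) :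
    volume.restrict (Ioc q r) ≤ timeMeasure T := by
  rw [← Measure.restrict_congr_set Ioo_ae_eq_Ioc]
  exact Measure.restrict_mono (Ioo_subset_Ioo hq hr) le_rfl

theorem intervalIntegrable_of_integrable_timeMeasure {g : ℝ → ℝ}
    (hg : Integrable g (timeMeasure T)) (hq : 0 ≤ q) (hqr : q ≤ r) (hr : r ≤ T) :
    IntervalIntegrable g volume q r :=
  (intervalIntegrable_iff_integrableOn_Ioc_of_le hqr).2
    (hg.mono_measure (restrict_Ioc_le_timeMeasure hq hr))

namespace IsSolution

theorem integral_relForm_add_systemOp_sub (hΩ : IsOpen Ω) (hν : 0 ≤ ν) (hf : MemZ Ω T ν f)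
    (hv : IsSolution Ω T ν f v₀ v ξ) (hq : 0 ≤ q) (hqr : q ≤ r) (hr : r ≤ T)
    (hξ : ∀ᵐ τ ∂(volume.restrict (Ioo q r)), ξ τ = 0)
    (hφ : IsC1Sol Ω φ) (hφq : hφ.curve q = 0) (hφr : hφ.curve r = 0) (K : L2sol Ω → ℝ≥0∞) :
    ∫ τ in q..r, (relForm ν K (v τ) (hφ.curve τ)
        + systemOp ν (f τ) (hφ.curve τ) (hφ.velocity τ)
            ((v τ - hφ.curve τ : L2sol Ω) : L2 Ω (Fin d))
        - (K (hφ.curve τ)).toReal * (relEnergy (v τ) (hφ.curve τ) + ξ τ))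
      = (∫ τ in q..r, energyRate ν (f τ) (v τ))
        - ∫ τ in q..r, weakRate ν (f τ) (v τ) (hφ.curve τ) (hφ.velocity τ) := by
  have integrable_energyRate := intervalIntegrable_of_integrable_timeMeasure
    (hv.memX.integrable_energyRate hν hf) hq hqr hr
  have integrable_weakRate := intervalIntegrable_of_integrable_timeMeasure
    (hv.memX.integrable_weakRate hΩ hν hf hφ) hq hqr hr
  have integrable_inner :
      IntervalIntegrable (fun τ => inner ℝ (hφ.velocity τ) (hφ.curve τ)) volume q r :=
    (hφ.continuous_velocity.inner (𝕜 := ℝ) hφ.continuous_curve).intervalIntegrable q r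
  have integral_inner : ∫ τ in q..r, inner ℝ (hφ.velocity τ) (hφ.curve τ) = 0 :=
    (hφ.integral_inner_velocity_curve q r).trans (by simp [hφq, hφr])
  have integral_congr : ∫ τ in q..r, (relForm ν K (v τ) (hφ.curve τ)
        + systemOp ν (f τ) (hφ.curve τ) (hφ.velocity τ)
            ((v τ - hφ.curve τ : L2sol Ω) : L2 Ω (Fin d))
        - (K (hφ.curve τ)).toReal * (relEnergy (v τ) (hφ.curve τ) + ξ τ))
      = ∫ τ in q..r, (energyRate ν (f τ) (v τ)
        - weakRate ν (f τ) (v τ) (hφ.curve τ) (hφ.velocity τ)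
        - inner ℝ (hφ.velocity τ) (hφ.curve τ)) := by
    refine intervalIntegral.integral_congr_ae_restrict ?_
    rw [uIoc_of_le hqr]
    rw [Measure.restrict_congr_set Ioo_ae_eq_Ioc] at hξ
    filter_upwards [hξ, ae_mono (restrict_Ioc_le_timeMeasure hq hr)
      (hv.memX.relForm_add_systemOp_sub_curve hΩ hν hf hφ K)] with τ ξ_eq integrand_eq
    rw [ξ_eq, add_zero, integrand_eq]
  rw [integral_congr, intervalIntegral.integral_sub
      (integrable_energyRate.sub integrable_weakRate) integrable_inner, integral_inner, sub_zero,
    intervalIntegral.integral_sub integrable_energyRate integrable_weakRate]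

theorem energy_le_of_isC1Sol (hΩ : IsOpen Ω) (hν : 0 ≤ ν) (hf : MemZ Ω T ν f)
    (hv : IsSolution Ω T ν f v₀ v ξ) (hq : 0 ≤ q) (hqr : q ≤ r) (hr : r ≤ T)
    (hξ : ∀ᵐ τ ∂(volume.restrict (Ioo q r)), ξ τ = 0)
    (hφ : IsC1Sol Ω φ) (hφq : hφ.curve q = 0) (hφr : hφ.curve r = 0) :
    ∃ a b : ℝ, Tendsto (fun τ => relEnergy (v τ) 0 + ξ τ) (rightLim T r) (𝓝 a) ∧
      Tendsto (fun τ => relEnergy (v τ) 0 + ξ τ) (leftLim q) (𝓝 b) ∧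
      a + ((∫ τ in q..r, energyRate ν (f τ) (v τ))
        - ∫ τ in q..r, weakRate ν (f τ) (v τ) (hφ.curve τ) (hφ.velocity τ)) ≤ b := by
  obtain ⟨a, b, ha, hb, hab⟩ := hv.relative_energy _ (isAdmissible_regMeasure hΩ T hν) _ _
    (hφ.memY_curve hΩ T ν) (hφ.curve_mem_KDomain hΩ T ν) q r hq hqr hr
  rw [hv.integral_relForm_add_systemOp_sub hΩ hν hf hq hqr hr hξ hφ hφq hφr] at hab
  exact ⟨a, b, hφr ▸ ha, hφq ▸ hb, hab⟩

theorem exists_limits_energy_le (hΩ : IsOpen Ω) (hν : 0 ≤ ν) (hf : MemZ Ω T ν f)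
    (hv : IsSolution Ω T ν f v₀ v ξ) (hq : 0 ≤ q) (hqr : q ≤ r) (hr : r ≤ T)
    (hξ : ∀ᵐ τ ∂(volume.restrict (Ioo q r)), ξ τ = 0) :
    ∃ a b : ℝ, Tendsto (fun τ => relEnergy (v τ) 0 + ξ τ) (rightLim T r) (𝓝 a) ∧
      Tendsto (fun τ => relEnergy (v τ) 0 + ξ τ) (leftLim q) (𝓝 b) ∧
      a + ∫ τ in q..r, energyRate ν (f τ) (v τ) ≤ b := by
  have hψ := (isSolTest_zero (Ω := Ω)).isC1Sol_const
  have curve_const_smul τ : (hψ.const_smul 0).curve τ = 0 := by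
    rw [hψ.curve_time_smul, zero_smul]
  obtain ⟨a, b, ha, hb, hab⟩ := hv.energy_le_of_isC1Sol hΩ hν hf hq hqr hr hξ
    (hψ.const_smul 0) (curve_const_smul q) (curve_const_smul r)
  simp only [hψ.weakRate_const_smul hΩ, zero_mul, intervalIntegral.integral_zero,
    sub_zero] at hab
  exact ⟨a, b, ha, hb, hab⟩

theorem locallyIntegrable_energy (hv : IsSolution Ω T ν f v₀ v ξ) :
    LocallyIntegrable ((Ioo 0 T).indicator fun τ => relEnergy (v τ) 0 + ξ τ) := by
  have memLp_two : MemLp v 2 (timeMeasure T) := hv.memX.bounded.mono_exponent le_top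
  have integrable_relEnergy : Integrable (fun τ => relEnergy (v τ) 0) (timeMeasure T) := by
    simpa only [relEnergy, sub_zero] using
      (memLp_two.integrable_norm_pow two_ne_zero).const_mul (1 / 2)
  refine Integrable.locallyIntegrable ((integrable_indicator_iff measurableSet_Ioo).2 ?_)
  exact integrable_relEnergy.add (memLp_one_iff_integrable.1 (hv.memLp.mono_exponent le_top))

theorem ae_eq_of_tendsto_energy (hv : IsSolution Ω T ν f v₀ v ξ) :
    ∀ᵐ q, q ∈ Ioo 0 T → ∀ b,
      (Tendsto (fun τ => relEnergy (v τ) 0 + ξ τ) (rightLim T q) (𝓝 b) →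
        b = relEnergy (v q) 0 + ξ q) ∧
      (Tendsto (fun τ => relEnergy (v τ) 0 + ξ τ) (leftLim q) (𝓝 b) →
        b = relEnergy (v q) 0 + ξ q) := by
  filter_upwards [ae_eq_of_tendsto_nhdsGT_inf_ae hv.locallyIntegrable_energy,
    ae_eq_of_tendsto_nhdsLT_inf_ae hv.locallyIntegrable_energy] with q hright hleft hq b
  have indicator_eventuallyEq {l : Filter ℝ} (hl : l ≤ 𝓝 q) :
      (fun τ => relEnergy (v τ) 0 + ξ τ) =ᶠ[l]
        (Ioo 0 T).indicator fun τ => relEnergy (v τ) 0 + ξ τ :=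
    (eqOn_indicator.eventuallyEq_of_mem (hl (isOpen_Ioo.mem_nhds hq))).symm
  rw [indicator_of_mem hq] at hright hleft
  rw [rightLim, leftLim, if_pos hq.1, if_pos hq.2]
  exact ⟨fun h => hright b
      (h.congr' (indicator_eventuallyEq (inf_le_left.trans nhdsWithin_le_nhds))),
    fun h => hleft b
      (h.congr' (indicator_eventuallyEq (inf_le_left.trans nhdsWithin_le_nhds)))⟩

theorem exists_null_energy_le (hΩ : IsOpen Ω) (hν : 0 ≤ ν) (hf : MemZ Ω T ν f)
    (hv : IsSolution Ω T ν f v₀ v ξ) (hs : 0 ≤ s) (ht : t ≤ T)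
    (hξ : ∀ᵐ τ ∂(volume.restrict (Ioo s t)), ξ τ = 0) :
    ∃ N : Set ℝ, volume N = 0 ∧ ∀ q ∈ Ioo s t \ N, ∀ r ∈ Ioo s t \ N, q < r →
      1 / 2 * ‖v r‖ ^ 2 - 1 / 2 * ‖v q‖ ^ 2
        + ∫ τ in q..r, energyRate ν (f τ) (v τ) ≤ 0 := by
  have ae_limit_eq : ∀ᵐ q, q ∈ Ioo s t → ∀ b,
      (Tendsto (fun τ => relEnergy (v τ) 0 + ξ τ) (rightLim T q) (𝓝 b) →
        b = 1 / 2 * ‖v q‖ ^ 2) ∧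
      (Tendsto (fun τ => relEnergy (v τ) 0 + ξ τ) (leftLim q) (𝓝 b) →
        b = 1 / 2 * ‖v q‖ ^ 2) := by
    filter_upwards [hv.ae_eq_of_tendsto_energy, (ae_restrict_iff' measurableSet_Ioo).1 hξ]
      with q limit_eq ξ_eq hq
    simpa only [relEnergy, sub_zero, ξ_eq hq, add_zero]
      using limit_eq (Ioo_subset_Ioo hs ht hq)
  refine ⟨_, ae_limit_eq, fun q ⟨hq, hqN⟩ r ⟨hr, hrN⟩ hqr => ?_⟩
  obtain ⟨a, b, ha, hb, hab⟩ := hv.exists_limits_energy_le hΩ hν hf (hs.trans hq.1.le) hqr.le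
    (hr.2.le.trans ht) (ae_restrict_of_ae_restrict_of_subset (Ioo_subset_Ioo hq.1.le hr.2.le) hξ)
  have a_eq := (not_not.1 hrN hr a).1 ha
  have b_eq := (not_not.1 hqN hq b).2 hb
  linarith

theorem integral_weakRate_eq_zero (hΩ : IsOpen Ω) (hν : 0 ≤ ν) (hf : MemZ Ω T ν f)
    (hv : IsSolution Ω T ν f v₀ v ξ) (hs : 0 ≤ s) (hst : s ≤ t) (ht : t ≤ T)
    (hξ : ∀ᵐ τ ∂(volume.restrict (Ioo s t)), ξ τ = 0)
    (hφ : IsC1Sol Ω φ) (hφs : hφ.curve s = 0) (hφt : hφ.curve t = 0) :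
    ∫ τ in s..t, weakRate ν (f τ) (v τ) (hφ.curve τ) (hφ.velocity τ) = 0 := by
  set I := ∫ τ in s..t, weakRate ν (f τ) (v τ) (hφ.curve τ) (hφ.velocity τ)
  obtain ⟨a, b, ha, hb, -⟩ := hv.exists_limits_energy_le hΩ hν hf hs hst ht hξ
  have mul_integral_le c : a + ((∫ τ in s..t, energyRate ν (f τ) (v τ)) - c * I) ≤ b := by
    have := rightLim_neBot T t
    have := leftLim_neBot s
    obtain ⟨a', b', ha', hb', h⟩ := hv.energy_le_of_isC1Sol hΩ hν hf hs hst ht hξ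
      (hφ.const_smul c) (by rw [hφ.curve_time_smul, hφs, smul_zero])
      (by rw [hφ.curve_time_smul, hφt, smul_zero])
    simp only [hφ.weakRate_const_smul hΩ, intervalIntegral.integral_const_mul] at h
    rwa [tendsto_nhds_unique ha ha', tendsto_nhds_unique hb hb']
  by_contra integral_ne_zero
  have := mul_integral_le ((a + (∫ τ in s..t, energyRate ν (f τ) (v τ)) - b - 1) / I)
  rw [div_mul_cancel₀ _ integral_ne_zero] at this
  linarith

end IsSolution

theorem IsC1cSol.exists_curve_eq_zero (hφ : IsC1cSol Ω s t φ) :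
    ∃ h : IsC1Sol Ω φ, ∀ τ ∉ Ioo s t, h.curve τ = 0 := by
  obtain ⟨h, J, -, hJ, φ_eq_zero⟩ := hφ
  refine ⟨h, fun τ hτ => Subtype.ext (Lp.ext ((h.curve_ae_eq τ).trans ?_))⟩
  rw [show φ τ = 0 from funext (φ_eq_zero τ fun hτJ => hτ (hJ hτJ))]
  exact (Lp.coeFn_zero _ _ _).symm

end Solutions

end EnergyVariational

end

open MeasureTheory Set EnergyVariational in
theorem proposition2_general {d : ℕ} (Ω : Set (Eu d)) (hΩ : IsOpen Ω)
    (T ν : ℝ) (hν : 0 ≤ ν)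
    (f : ℝ → Hm1 Ω × L2 Ω (Fin d)) (hf : MemZ Ω T ν f) (v₀ : L2sol Ω)
    (v : ℝ → L2sol Ω) (ξ : ℝ → ℝ) (hv : IsSolution Ω T ν f v₀ v ξ)
    (s t : ℝ) (hs : 0 ≤ s) (hst : s ≤ t) (ht : t ≤ T)
    (hξ : ∀ᵐ τ ∂(volume.restrict (Ioo s t)), ξ τ = 0) :
    (∃ N : Set ℝ, volume N = 0 ∧ ∀ q ∈ Ioo s t \ N, ∀ r ∈ Ioo s t \ N, q < r →
      1 / 2 * ‖v r‖ ^ 2 - 1 / 2 * ‖v q‖ ^ 2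
        + ∫ τ in q..r, (ν * ‖weakGrad Ω (v τ : L2 Ω (Fin d))‖ ^ 2
            - forcePair (f τ) (v τ : L2 Ω (Fin d))) ≤ 0) ∧
    ∀ φ : ℝ → Eu d → Eu d, IsC1cSol Ω s t φ →
      ∫ τ in s..t,
        (ν * (∫ x in Ω, inner ℝ (weakGrad Ω (v τ : L2 Ω (Fin d)) x) (grad (φ τ) x))
          - (∫ x in Ω, ∑ i, ∑ j,
              (v τ : L2 Ω (Fin d)) x i * (v τ : L2 Ω (Fin d)) x j * grad (φ τ) x (i, j))
          - (∫ x in Ω, inner ℝ ((v τ : L2 Ω (Fin d)) x) (timeDeriv φ τ x))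
          - forcePair (f τ) (toL2 Ω (φ τ))) = 0 := by
  refine ⟨hv.exists_null_energy_le hΩ hν hf hs ht hξ, fun φ hφ => ?_⟩
  obtain ⟨hφ', curve_eq_zero⟩ := hφ.exists_curve_eq_zero
  have integral_eq_zero := hv.integral_weakRate_eq_zero hΩ hν hf hs hst ht hξ hφ'
    (curve_eq_zero s (by simp)) (curve_eq_zero t (by simp))
  simpa only [hφ'.weakRate_eq hΩ] using integral_eq_zero

open MeasureTheory Set EnergyVariational in
theorem proposition2 {d : ℕ} (hd : 2 ≤ d) (Ω : Set (Eu d)) (hΩ_open : IsOpen Ω)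
    (hΩ_conn : IsConnected Ω) (hΩ_bdd : Bornology.IsBounded Ω)
    (T ν : ℝ) (hT : 0 < T) (hν : 0 ≤ ν)
    (f : ℝ → Hm1 Ω × L2 Ω (Fin d)) (hf : MemZ Ω T ν f) (v₀ : L2sol Ω)
    (v : ℝ → L2sol Ω) (ξ : ℝ → ℝ) (hv : IsSolution Ω T ν f v₀ v ξ)
    (s t : ℝ) (hs : 0 < s) (hst : s < t) (ht : t < T)
    (hξ : ∀ᵐ τ ∂(volume.restrict (Ioo s t)), ξ τ = 0) :
    (∃ N : Set ℝ, volume N = 0 ∧ ∀ q ∈ Ioo s t \ N, ∀ r ∈ Ioo s t \ N, q < r →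
      1 / 2 * ‖v r‖ ^ 2 - 1 / 2 * ‖v q‖ ^ 2
        + ∫ τ in q..r, (ν * ‖weakGrad Ω (v τ : L2 Ω (Fin d))‖ ^ 2
            - forcePair (f τ) (v τ : L2 Ω (Fin d))) ≤ 0) ∧
    ∀ φ : ℝ → Eu d → Eu d, IsC1cSol Ω s t φ →
      ∫ τ in s..t,
        (ν * (∫ x in Ω, inner ℝ (weakGrad Ω (v τ : L2 Ω (Fin d)) x) (grad (φ τ) x))
          - (∫ x in Ω, ∑ i, ∑ j,
              (v τ : L2 Ω (Fin d)) x i * (v τ : L2 Ω (Fin d)) x j * grad (φ τ) x (i, j))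
          - (∫ x in Ω, inner ℝ ((v τ : L2 Ω (Fin d)) x) (timeDeriv φ τ x))
          - forcePair (f τ) (toL2 Ω (φ τ))) = 0 :=
  proposition2_general Ω hΩ_open T ν hν f hf v₀ v ξ hv s t hs.le hst.le ht.le hξ
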